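/- **Definitions.** A *contact relation* on a Boolean algebra $A$ (with $0=1$ allowed; complement $a^*$) is a binary relation $\rho$ such that $a\neq 0\Rightarrow a\rho a$; $a\rho b\Rightarrow a\ne 0\ne b$; $a\rho b\Rightarrow b\rho a$; and $a\rho(b\vee c)\iff a\rho b$ or $a\rho c$. Write $a\ll b$ if not $a\rho b^*$. A *complete local contact algebra* (CLCA) is a triple $(A,\rho,\mathbb B)$ with $A$ a complete Boolean algebra, $\rho$ a contact relation on $A$ and $\mathbb B$ a (possibly non-proper) ideal of $A$ such that: if $a\in\mathbb B$ and $a\ll c$ then $a\ll b\ll c$ for some $b\in\mathbb B$; if $a\rho b$ then $a\rho(c\wedge b)$ for some $c\in\mathbb B$; if $a\ne0$ then $0\neq b\ll a$ for some $b\in\mathbb B$. An *LCA-isomorphism* is a Boolean isomorphism preserving and reflecting $\rho$ and membership in $\mathbb B$. A *$\delta$-ideal* of $(A,\rho,\mathbb B)$ is an ideal $I\subseteq\mathbb B$ such that every $a\in I$ satisfies $a\ll b$ for some $b\in I$; the $\delta$-ideals, ordered by inclusion, form a complete lattice $I(A,\rho,\mathbb B)$, and $I_a=\{b\in\mathbb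 B: b\ll a\}$ is a $\delta$-ideal for every $a\in A$. $\mathbf{MDHLC}$ is the category whose objects are the CLCAs and whose morphisms $\varphi:(A,\rho,\mathbb B)\to(B,\eta,\mathbb B')$ are the maps $\varphi:A\to I(B,\eta,\mathbb B')$ (multi-valued maps from $A$ to $B$) such that, for all $a,b\in A$: $\varphi(a\wedge b)=\varphi(a)\wedge\varphi(b)$; $\varphi(a)=\bigvee\{\varphi(b): b\in\mathbb B,\ b\ll a\}$; $\varphi(0)=\{0\}$; $\varphi(a_1\vee a_2)\subseteq\varphi(b_1)\vee\varphi(b_2)$ whenever $a_i,b_i\in\mathbb B$ and $a_i\ll b_i$ for $i=1,2$; and every element of $\mathbb B'$ belongs to $\varphi(a)$ for some $a\in\mathbb B$. Composition is $(\psi\diamond\varphi)(a)=\bigvee\{\psi(b): b\in\varphi(a)\}$, and the identity of $(A,\rho,\mathbb B)$ is $a\mapsto I_a$. For an LCA-isomorphism $e:(A,\rho,\mathbb B)\to(B,\eta,\mathbb B')$ let $\widetilde e$ be the $\mathbf{MDHLC}$-morphism $a\mapsto I_{e(a)}$. $\mathbf{HLC}$ is the category of locally compact Hausdorff spaces and continuous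 maps. $\Delta^t:\mathbf{HLC}\to\mathbf{MDHLC}$ is the contravariant functor sending $X$ to the CLCA $(RC(X),\rho_X,CR(X))$ of regular closed subsets of $X$, with $F\rho_XG\iff F\cap G\ne\emptyset$ and $CR(X)$ the ideal of compact regular closed sets, and sending $f:X\to Y$ to $G\mapsto\{F\in CR(X): F\subseteq f^{-1}(\operatorname{int}G)\}$ for $G\in RC(Y)$. For a CLCA $(A,\rho,\mathbb B)$ put $aC_\rho b\iff a\rho b$ or $a,b\notin\mathbb B$. A *cluster* is a non-empty $\sigma\subseteq A$ such that $a,b\in\sigma\Rightarrow aC_\rho b$; $a\vee b\in\sigma\Rightarrow a\in\sigma$ or $b\in\sigma$; and $a\in\sigma$ whenever $aC_\rho b$ for all $b\in\sigma$. It is *bounded* if $\sigma\cap\mathbb B\neq\emptyset$. The set of all clusters carries the topology with closed base the sets $\{\sigma: a\in\sigma\}$, $a\in A$, and $\Psi^a(A,\rho,\mathbb B)$ is its subspace of bounded clusters. $\Delta^a:\mathbf{MDHLC}\to\mathbf{HLC}$ is the contravariant functor sending $(A,\rho,\mathbb B)$ to $\Psi^a(A,\rho,\mathbb B)$ and $\varphi:(A,\rho,\mathbb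 B)\to(B,\eta,\mathbb B')$ to the map $f_\varphi:\Psi^a(B,\eta,\mathbb B')\to\Psi^a(A,\rho,\mathbb B)$, where $f_\varphi(\sigma')$ is the unique $\sigma\in\Psi^a(A,\rho,\mathbb B)$ with $\sigma\cap\mathbb B=\{a\in\mathbb B:\ \varphi(b)\cap\sigma'\neq\emptyset\text{ for all }b\in A\text{ with }a\ll b\}$. **Proposition.** The identity functor of $\mathbf{MDHLC}$ and the functor $\Delta^t\circ\Delta^a$ are naturally isomorphic. More precisely, for every CLCA $(A,\rho,\mathbb B)$ the map $\lambda^g_A(a)=\{\sigma\in\Psi^a(A,\rho,\mathbb B): a\in\sigma\}$ is an LCA-isomorphism from $(A,\rho,\mathbb B)$ onto $\Delta^t(\Delta^a(A,\rho,\mathbb B))$, and the morphisms $\widetilde{\lambda^g_A}$ are the components of a natural isomorphism $\mathrm{Id}_{\mathbf{MDHLC}}\cong\Delta^t\circ\Delta^a$. -/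

import Mathlib

open CategoryTheory Opposite

universe u

namespace RegionDuality

/-! ### Contact algebras and local contact algebras -/

/-- `C` is a contact relation on the Boolean algebra `A`, i.e. `(A, C)` is a contact algebra. -/
structure IsContact {A : Type u} [BooleanAlgebra A] (C : A → A → Prop) : Prop where
  refl_of_ne_bot : ∀ a, a ≠ ⊥ → C a a
  ne_bot : ∀ a b, C a b → a ≠ ⊥ ∧ b ≠ ⊥
  symm : ∀ a b, C a b → C b a
  sup_iff : ∀ a b c, C a (b ⊔ c) ↔ C a b ∨ C a c

/-- Non-tangential inclusion with respect to a relation `C`: `a` is not in contact with the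
complement of `b`. -/
def NonTangential {A : Type u} [BooleanAlgebra A] (C : A → A → Prop) (a b : A) : Prop :=
  ¬ C a bᶜ

/-- A local contact algebra structure `(A, ρ, 𝔹)` on a Boolean algebra `A`: a contact relation `ρ`
and a (possibly non-proper) ideal `𝔹` of bounded elements, satisfying (BC1), (BC2), (BC3). -/
class LocalContactAlgebra (A : Type u) [BooleanAlgebra A] where
  contact : A → A → Prop
  bounded : Order.Ideal A
  isContact : IsContact contact
  bc1 : ∀ a c, a ∈ bounded → NonTangential contact a c →
    ∃ b ∈ bounded, NonTangential contact a b ∧ NonTangential contact b c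
  bc2 : ∀ a b, contact a b → ∃ c ∈ bounded, contact a (c ⊓ b)
  bc3 : ∀ a, a ≠ ⊥ → ∃ b ∈ bounded, b ≠ ⊥ ∧ NonTangential contact b a

open LocalContactAlgebra (contact bounded)

/-- Non-tangential inclusion in a local contact algebra. -/
def WellInside {A : Type u} [BooleanAlgebra A] [LocalContactAlgebra A] (a b : A) : Prop :=
  NonTangential contact a b

infix:50 " ≪ " => WellInside

section Basic

variable {A : Type u} [BooleanAlgebra A] [LocalContactAlgebra A]

theorem contact_symm {a b : A} (h : contact a b) : contact b a :=
  LocalContactAlgebra.isContact.symm a b h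

theorem contact_sup {a b c : A} : contact a (b ⊔ c) ↔ contact a b ∨ contact a c :=
  LocalContactAlgebra.isContact.sup_iff a b c

theorem contact_mono_right {a b c : A} (hbc : b ≤ c) (h : contact a b) : contact a c := by
  rw [← sup_eq_right.2 hbc]
  exact contact_sup.2 (Or.inl h)

theorem contact_mono {a b c d : A} (hac : a ≤ c) (hbd : b ≤ d) (h : contact a b) :
    contact c d :=
  contact_mono_right hbd (contact_symm (contact_mono_right hac (contact_symm h)))

theorem not_contact_bot (a : A) : ¬ contact a (⊥ : A) := fun h =>
  (LocalContactAlgebra.isContact.ne_bot _ _ h).2 rfl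

theorem WellInside.mono {a b c d : A} (hab : a ≤ b) (h : b ≪ c) (hcd : c ≤ d) : a ≪ d :=
  fun h' => h (contact_mono hab (compl_le_compl hcd) h')

theorem WellInside.compl {a b : A} (h : a ≪ b) : bᶜ ≪ aᶜ := fun h' => by
  rw [compl_compl] at h'
  exact h (contact_symm h')

theorem WellInside.le {a b : A} (h : a ≪ b) : a ≤ b := by
  by_contra hab
  have hne : a ⊓ bᶜ ≠ ⊥ := fun h0 => hab (by
    rw [← sdiff_eq, sdiff_eq_bot_iff] at h0
    exact h0)
  exact h (contact_mono inf_le_left inf_le_right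
    (LocalContactAlgebra.isContact.refl_of_ne_bot _ hne))

theorem WellInside.sup {a b c d : A} (h : a ≪ c) (h' : b ≪ d) : a ⊔ b ≪ c ⊔ d := fun hc => by
  rw [compl_sup] at hc
  rcases contact_sup.1 (contact_symm hc) with h1 | h1
  · exact h (contact_mono le_rfl inf_le_left (contact_symm h1))
  · exact h' (contact_mono le_rfl inf_le_right (contact_symm h1))

theorem WellInside.inf {a b c d : A} (h : a ≪ c) (h' : b ≪ d) : a ⊓ b ≪ c ⊓ d := fun hc => by
  rw [compl_inf] at hc
  rcases contact_sup.1 hc with h1 | h1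
  · exact h (contact_mono inf_le_left le_rfl h1)
  · exact h' (contact_mono inf_le_right le_rfl h1)

theorem bot_wellInside (a : A) : (⊥ : A) ≪ a := fun h => not_contact_bot _ (contact_symm h)

theorem WellInside.interp {a c : A} (ha : a ∈ bounded (A := A)) (h : a ≪ c) :
    ∃ b ∈ bounded (A := A), a ≪ b ∧ b ≪ c :=
  LocalContactAlgebra.bc1 a c ha h

theorem exists_wellInside {a : A} (ha : a ∈ bounded (A := A)) :
    ∃ b ∈ bounded (A := A), a ≪ b := by
  have h : a ≪ ⊤ := fun h => by
    rw [compl_top] at h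
    exact not_contact_bot _ h
  obtain ⟨b, hb, hab, -⟩ := h.interp ha
  exact ⟨b, hb, hab⟩

end Basic

/-! ### δ-ideals -/

/-- A δ-ideal of a local contact algebra `(A, ρ, 𝔹)`: an ideal `I ⊆ 𝔹` such that every element of
`I` is non-tangentially included in another element of `I`. -/
structure DeltaIdeal (A : Type u) [BooleanAlgebra A] [LocalContactAlgebra A] extends
    Order.Ideal A where
  le_bounded : ∀ a ∈ carrier, a ∈ bounded (A := A)
  exists_wellInside : ∀ a ∈ carrier, ∃ b ∈ carrier, a ≪ b

namespace DeltaIdeal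

variable {A : Type u} [BooleanAlgebra A] [LocalContactAlgebra A]

instance : SetLike (DeltaIdeal A) A where
  coe I := I.carrier
  coe_injective I J h := by
    obtain ⟨I, _, _⟩ := I
    obtain ⟨J, _, _⟩ := J
    have : I = J := Order.Ideal.ext h
    subst this
    rfl

instance : PartialOrder (DeltaIdeal A) := .ofSetLike (DeltaIdeal A) A

variable {I J : DeltaIdeal A} {a b : A}

theorem ext (h : ∀ a, a ∈ I ↔ a ∈ J) : I = J := SetLike.ext h

theorem mem_of_le (h : a ≤ b) (hb : b ∈ I) : a ∈ I := I.lower' h hb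

theorem sup_mem (ha : a ∈ I) (hb : b ∈ I) : a ⊔ b ∈ I :=
  Order.Ideal.sup_mem (s := I.toIdeal) ha hb

theorem bot_mem (I : DeltaIdeal A) : (⊥ : A) ∈ I := Order.Ideal.bot_mem I.toIdeal

theorem mem_bounded (ha : a ∈ I) : a ∈ bounded (A := A) := I.le_bounded a ha

theorem exists_mem (ha : a ∈ I) : ∃ b ∈ I, a ≪ b := I.exists_wellInside a ha

/-- Constructor of δ-ideals. -/
def ofSet (S : Set A) (h0 : ⊥ ∈ S) (hle : ∀ a b, a ≤ b → b ∈ S → a ∈ S)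
    (hsup : ∀ a b, a ∈ S → b ∈ S → a ⊔ b ∈ S) (hb : ∀ a ∈ S, a ∈ bounded (A := A))
    (hw : ∀ a ∈ S, ∃ b ∈ S, a ≪ b) : DeltaIdeal A where
  carrier := S
  lower' := fun a b hba ha => hle b a hba ha
  nonempty' := ⟨⊥, h0⟩
  directed' := fun a ha b hb => ⟨a ⊔ b, hsup a b ha hb, le_sup_left, le_sup_right⟩
  le_bounded := hb
  exists_wellInside := hw

/-- The principal δ-ideal `I_a = {b ∈ 𝔹 | b ≪ a}`. -/
def principal (a : A) : DeltaIdeal A :=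
  ofSet {b | b ∈ bounded (A := A) ∧ b ≪ a}
    ⟨Order.Ideal.bot_mem _, bot_wellInside a⟩
    (fun _ _ hxy hy => ⟨Order.Ideal.lower _ hxy hy.1, hy.2.mono hxy le_rfl⟩)
    (fun _ _ hx hy => ⟨Order.Ideal.sup_mem hx.1 hy.1,
      (hx.2.sup hy.2).mono le_rfl (sup_le le_rfl le_rfl)⟩)
    (fun _ hx => hx.1)
    (fun _ hx => by
      obtain ⟨y, hy, hxy, hya⟩ := hx.2.interp hx.1
      exact ⟨y, ⟨hy, hya⟩, hxy⟩)

theorem mem_principal : b ∈ principal a ↔ b ∈ bounded (A := A) ∧ b ≪ a := Iff.rfl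

/-- The join of a set of δ-ideals: the elements below a finite join of members. -/
def join (S : Set (DeltaIdeal A)) : DeltaIdeal A :=
  ofSet {x | ∃ t : Finset A, (∀ y ∈ t, ∃ I ∈ S, y ∈ I) ∧ x ≤ t.sup id}
    ⟨∅, by simp⟩
    (fun _ _ hxy ⟨t, ht, hy⟩ => ⟨t, ht, hxy.trans hy⟩)
    (fun x y ⟨t, ht, hx⟩ ⟨s, hs, hy⟩ => by
      classical
      refine ⟨t ∪ s, fun z hz => ?_, ?_⟩
      · rcases Finset.mem_union.1 hz with h | h
        exacts [ht z h, hs z h]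
      · rw [Finset.sup_union]
        exact sup_le_sup hx hy)
    (fun x ⟨t, ht, hx⟩ => Order.Ideal.lower _ hx
      (Finset.sup_induction (Order.Ideal.bot_mem _)
        (fun _ h _ h' => Order.Ideal.sup_mem h h')
        (fun y hy => by
          obtain ⟨I, -, hI⟩ := ht y hy
          exact mem_bounded hI)))
    (fun x ⟨t, ht, hx⟩ => by
      classical
      have key : ∀ t : Finset A, (∀ y ∈ t, ∃ I ∈ S, y ∈ I) →
          ∃ s : Finset A, (∀ y ∈ s, ∃ I ∈ S, y ∈ I) ∧ t.sup id ≪ s.sup id := by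
        intro t
        induction t using Finset.induction_on with
        | empty => exact fun _ => ⟨∅, by simp, bot_wellInside _⟩
        | insert y t _ ih =>
          intro ht
          obtain ⟨s, hs, hts⟩ := ih (fun z hz => ht z (Finset.mem_insert_of_mem hz))
          obtain ⟨I, hI, hyI⟩ := ht y (Finset.mem_insert_self y t)
          obtain ⟨z, hz, hyz⟩ := exists_mem hyI
          refine ⟨insert z s, fun w hw => ?_, ?_⟩
          · rcases Finset.mem_insert.1 hw with rfl | h
            exacts [⟨I, hI, hz⟩, hs w h]
          · rw [Finset.sup_insert, Finset.sup_insert]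
            exact hyz.sup hts
      obtain ⟨s, hs, hts⟩ := key t ht
      exact ⟨s.sup id, ⟨s, hs, le_rfl⟩, hts.mono hx le_rfl⟩)

theorem isLUB_join (S : Set (DeltaIdeal A)) : IsLUB S (join S) := by
  refine ⟨fun I hI x hx => ⟨{x}, ?_, by simp⟩, fun J hJ x => ?_⟩
  · intro y hy
    rw [Finset.mem_singleton.1 hy]
    exact ⟨I, hI, hx⟩
  · rintro ⟨t, ht, hx⟩
    refine mem_of_le hx (Finset.sup_induction (p := fun y => y ∈ J) (bot_mem J)
      (fun _ h _ h' => sup_mem h h') fun y hy => ?_)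
    obtain ⟨I, hI, hyI⟩ := ht y hy
    exact hJ hI hyI

/-- The meet of two δ-ideals is their intersection. -/
def meet (I J : DeltaIdeal A) : DeltaIdeal A :=
  ofSet {x | x ∈ I ∧ x ∈ J} ⟨bot_mem I, bot_mem J⟩
    (fun _ _ h hb => ⟨mem_of_le h hb.1, mem_of_le h hb.2⟩)
    (fun _ _ ha hb => ⟨sup_mem ha.1 hb.1, sup_mem ha.2 hb.2⟩)
    (fun _ ha => mem_bounded ha.1)
    (fun a ha => by
      obtain ⟨b, hb, hab⟩ := exists_mem ha.1
      obtain ⟨c, hc, hac⟩ := exists_mem ha.2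
      exact ⟨b ⊓ c, ⟨mem_of_le inf_le_left hb, mem_of_le inf_le_right hc⟩,
        (hab.inf hac).mono (le_inf le_rfl le_rfl) le_rfl⟩)

instance : SupSet (DeltaIdeal A) := ⟨join⟩

/-- The lattice of δ-ideals, ordered by inclusion. -/
instance : CompleteLattice (DeltaIdeal A) where
  __ := completeLatticeOfSup (DeltaIdeal A) isLUB_join
  inf := meet
  inf_le_left _ _ _ h := h.1
  inf_le_right _ _ _ h := h.2
  le_inf _ _ _ h h' _ hx := ⟨h hx, h' hx⟩

theorem mem_inf : a ∈ I ⊓ J ↔ a ∈ I ∧ a ∈ J := Iff.rfl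

theorem mem_sSup {S : Set (DeltaIdeal A)} :
    a ∈ sSup S ↔ ∃ t : Finset A, (∀ y ∈ t, ∃ I ∈ S, y ∈ I) ∧ a ≤ t.sup id := Iff.rfl

theorem mem_sSup_of_mem {S : Set (DeltaIdeal A)} (hI : I ∈ S) (ha : a ∈ I) : a ∈ sSup S :=
  le_sSup hI ha

/-- A nonempty directed join of δ-ideals is a union. -/
theorem mem_sSup_image {B : Type u} [BooleanAlgebra B] {f : B → DeltaIdeal A}
    (hf : Monotone f) {S : Set B} (h0 : ⊥ ∈ S)
    (hsup : ∀ x ∈ S, ∀ y ∈ S, x ⊔ y ∈ S) : a ∈ sSup (f '' S) ↔ ∃ b ∈ S, a ∈ f b := by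
  classical
  constructor
  · rintro ⟨t, ht, ha⟩
    suffices h : ∃ b ∈ S, t.sup id ∈ f b by
      obtain ⟨b, hb, h⟩ := h
      exact ⟨b, hb, mem_of_le ha h⟩
    refine Finset.sup_induction (p := fun y => ∃ b ∈ S, y ∈ f b) ⟨⊥, h0, bot_mem _⟩ ?_ ?_
    · rintro x ⟨b, hb, hx⟩ y ⟨c, hc, hy⟩
      exact ⟨b ⊔ c, hsup b hb c hc, sup_mem (hf le_sup_left hx) (hf le_sup_right hy)⟩
    · intro y hy
      obtain ⟨_, ⟨b, hb, rfl⟩, h⟩ := ht y hy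
      exact ⟨b, hb, h⟩
  · rintro ⟨b, hb, h⟩
    exact mem_sSup_of_mem ⟨b, hb, rfl⟩ h

theorem mem_sup : a ∈ I ⊔ J ↔ ∃ x ∈ I, ∃ y ∈ J, a ≤ x ⊔ y := by
  constructor
  · intro h
    let K : DeltaIdeal A := ofSet {a | ∃ x ∈ I, ∃ y ∈ J, a ≤ x ⊔ y}
      ⟨⊥, bot_mem I, ⊥, bot_mem J, bot_le⟩
      (fun _ _ hab ⟨x, hx, y, hy, h⟩ => ⟨x, hx, y, hy, hab.trans h⟩)
      (fun _ _ ⟨x, hx, y, hy, h⟩ ⟨x', hx', y', hy', h'⟩ =>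
        ⟨x ⊔ x', sup_mem hx hx', y ⊔ y', sup_mem hy hy', by
          rw [sup_sup_sup_comm]
          exact sup_le_sup h h'⟩)
      (fun _ ⟨x, hx, y, hy, h⟩ => Order.Ideal.lower _ h
        (Order.Ideal.sup_mem (mem_bounded hx) (mem_bounded hy)))
      (fun _ ⟨x, hx, y, hy, h⟩ => by
        obtain ⟨x', hx', h1⟩ := exists_mem hx
        obtain ⟨y', hy', h2⟩ := exists_mem hy
        exact ⟨x' ⊔ y', ⟨x', hx', y', hy', le_rfl⟩, (h1.sup h2).mono h le_rfl⟩)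
    have hI : I ≤ K := fun x hx => ⟨x, hx, ⊥, bot_mem J, le_sup_left⟩
    have hJ : J ≤ K := fun y hy => ⟨⊥, bot_mem I, y, hy, le_sup_right⟩
    exact sup_le hI hJ h
  · rintro ⟨x, hx, y, hy, h⟩
    exact mem_of_le h (sup_mem ((le_sup_left : I ≤ I ⊔ J) hx) ((le_sup_right : J ≤ I ⊔ J) hy))

end DeltaIdeal

/-! ### The category `MDHLC` -/

/-- The objects of `MDHLC`: complete local contact algebras. -/
structure MDHLC : Type (u + 1) where
  carrier : Type u
  [completeBooleanAlgebra : CompleteBooleanAlgebra carrier]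
  [localContactAlgebra : LocalContactAlgebra carrier]

namespace MDHLC

instance : CoeSort MDHLC.{u} (Type u) := ⟨MDHLC.carrier⟩

attribute [instance] MDHLC.completeBooleanAlgebra MDHLC.localContactAlgebra

/-- The morphisms of `MDHLC`: multi-valued maps `A → B` satisfying (M1)-(M6); by (M1) the values
are δ-ideals of `B`. -/
structure Hom (A B : MDHLC.{u}) where
  toFun : A → DeltaIdeal B
  map_inf : ∀ a b, toFun (a ⊓ b) = toFun a ⊓ toFun b
  map_eq_sSup : ∀ a, toFun a = sSup (toFun '' {b | b ∈ bounded (A := A) ∧ b ≪ a})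
  map_bot : (toFun ⊥ : Set B) = {⊥}
  map_sup_le : ∀ a₁ a₂ b₁ b₂, a₁ ∈ bounded (A := A) → a₂ ∈ bounded (A := A) →
    b₁ ∈ bounded (A := A) → b₂ ∈ bounded (A := A) → a₁ ≪ b₁ → a₂ ≪ b₂ →
    toFun (a₁ ⊔ a₂) ≤ toFun b₁ ⊔ toFun b₂
  exists_mem : ∀ b ∈ bounded (A := B), ∃ a ∈ bounded (A := A), b ∈ toFun a

namespace Hom

variable {A B C D : MDHLC.{u}}

instance : CoeFun (Hom A B) (fun _ => A → DeltaIdeal B) := ⟨Hom.toFun⟩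

theorem ext' {φ ψ : Hom A B} (h : ∀ a b, b ∈ φ a ↔ b ∈ ψ a) : φ = ψ := by
  have : φ.toFun = ψ.toFun := funext fun a => DeltaIdeal.ext (h a)
  cases φ
  cases ψ
  cases this
  rfl

theorem mono (φ : Hom A B) : Monotone φ := fun a b h => by
  have := φ.map_inf a b
  rw [inf_eq_left.2 h] at this
  rw [this]
  exact inf_le_right

theorem mem_bot {φ : Hom A B} {b : B} : b ∈ φ ⊥ ↔ b = ⊥ := by
  have := φ.map_bot
  rw [← SetLike.mem_coe, this, Set.mem_singleton_iff]

theorem mem_iff (φ : Hom A B) {a : A} {x : B} :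
    x ∈ φ a ↔ ∃ b, (b ∈ bounded (A := A) ∧ b ≪ a) ∧ x ∈ φ b := by
  conv_lhs => rw [φ.map_eq_sSup a]
  exact DeltaIdeal.mem_sSup_image (S := {b | b ∈ bounded (A := A) ∧ b ≪ a}) φ.mono
    (DeltaIdeal.bot_mem (DeltaIdeal.principal a))
    (fun _ hx _ hy => DeltaIdeal.sup_mem (I := DeltaIdeal.principal a) hx hy)

/-- Constructor of morphisms with (M2)-(M5) stated through elements. -/
def ofMem (f : A → DeltaIdeal B) (hmono : Monotone f)
    (hinf : ∀ a b x, x ∈ f a → x ∈ f b → x ∈ f (a ⊓ b))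
    (hsup : ∀ a x, x ∈ f a → ∃ b ∈ bounded (A := A), b ≪ a ∧ x ∈ f b)
    (hbot : ∀ x ∈ f ⊥, x = ⊥)
    (hle : ∀ a₁ a₂ b₁ b₂ : A, a₁ ≪ b₁ → a₂ ≪ b₂ → ∀ x ∈ f (a₁ ⊔ a₂),
      ∃ y ∈ f b₁, ∃ z ∈ f b₂, x ≤ y ⊔ z)
    (hex : ∀ b ∈ bounded (A := B), ∃ a ∈ bounded (A := A), b ∈ f a) : Hom A B where
  toFun := f
  map_inf a b := le_antisymm (le_inf (hmono inf_le_left) (hmono inf_le_right))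
    fun x hx => hinf a b x hx.1 hx.2
  map_eq_sSup a := by
    refine le_antisymm (fun x hx => ?_) (sSup_le ?_)
    · obtain ⟨b, hb, hba, hxb⟩ := hsup a x hx
      exact DeltaIdeal.mem_sSup_of_mem ⟨b, ⟨hb, hba⟩, rfl⟩ hxb
    · rintro _ ⟨b, hb, rfl⟩
      exact hmono hb.2.le
  map_bot := Set.Subset.antisymm (fun x hx => hbot x hx)
    (Set.singleton_subset_iff.2 (DeltaIdeal.bot_mem _))
  map_sup_le a₁ a₂ b₁ b₂ _ _ _ _ h₁ h₂ x hx := DeltaIdeal.mem_sup.2 (hle a₁ a₂ b₁ b₂ h₁ h₂ x hx)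
  exists_mem := hex

/-- The identity morphism `a ↦ I_a`. -/
def id (A : MDHLC.{u}) : Hom A A :=
  ofMem DeltaIdeal.principal
    (fun _ _ h _ hx => ⟨hx.1, hx.2.mono le_rfl h⟩)
    (fun _ _ _ hx hy => ⟨hx.1, (hx.2.inf hy.2).mono (le_inf le_rfl le_rfl) le_rfl⟩)
    (fun _ _ hx => by
      obtain ⟨b, hb, h, h'⟩ := hx.2.interp hx.1
      exact ⟨b, hb, h', hx.1, h⟩)
    (fun _ hx => le_bot_iff.1 hx.2.le)
    (fun a₁ a₂ b₁ b₂ h₁ h₂ x hx =>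
      ⟨x ⊓ a₁, ⟨Order.Ideal.lower _ inf_le_left hx.1, h₁.mono inf_le_right le_rfl⟩,
        x ⊓ a₂, ⟨Order.Ideal.lower _ inf_le_left hx.1, h₂.mono inf_le_right le_rfl⟩, by
          rw [← inf_sup_left]
          exact le_inf le_rfl hx.2.le⟩)
    (fun b hb => by
      obtain ⟨a, ha, h⟩ := exists_wellInside hb
      exact ⟨a, ha, hb, h⟩)

theorem mem_id {a b : A} : b ∈ Hom.id A a ↔ b ∈ bounded (A := A) ∧ b ≪ a := Iff.rfl

/-- The underlying multi-valued map `a ↦ ⋁ {ψ(b) | b ∈ φ(a)}` of the composition. -/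
def compFun (φ : Hom A B) (ψ : Hom B C) (a : A) : DeltaIdeal C :=
  sSup (ψ '' {b | b ∈ φ a})

theorem mem_compFun {φ : Hom A B} {ψ : Hom B C} {a : A} {x : C} :
    x ∈ compFun φ ψ a ↔ ∃ b ∈ φ a, x ∈ ψ b :=
  DeltaIdeal.mem_sSup_image (S := {b | b ∈ φ a}) ψ.mono (DeltaIdeal.bot_mem _)
    (fun _ hx _ hy => DeltaIdeal.sup_mem hx hy)

/-- The composition `ψ ⋄ φ`, written in diagrammatic order. -/
def comp (φ : Hom A B) (ψ : Hom B C) : Hom A C where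
  toFun := compFun φ ψ
  map_inf a b := by
    refine DeltaIdeal.ext fun x => ?_
    rw [DeltaIdeal.mem_inf]
    simp only [mem_compFun]
    constructor
    · rintro ⟨y, hy, hx⟩
      exact ⟨⟨y, φ.mono inf_le_left hy, hx⟩, ⟨y, φ.mono inf_le_right hy, hx⟩⟩
    · rintro ⟨⟨y, hy, hx⟩, ⟨z, hz, hx'⟩⟩
      refine ⟨y ⊓ z, ?_, ?_⟩
      · rw [φ.map_inf]
        exact ⟨DeltaIdeal.mem_of_le inf_le_left hy, DeltaIdeal.mem_of_le inf_le_right hz⟩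
      · rw [ψ.map_inf]
        exact ⟨hx, hx'⟩
  map_eq_sSup a := by
    refine le_antisymm (fun x hx => ?_) (sSup_le ?_)
    · obtain ⟨y, hy, hxy⟩ := mem_compFun.1 hx
      obtain ⟨b, hb, hyb⟩ := φ.mem_iff.1 hy
      exact DeltaIdeal.mem_sSup_of_mem ⟨b, hb, rfl⟩ (mem_compFun.2 ⟨y, hyb, hxy⟩)
    · rintro _ ⟨b, hb, rfl⟩ x hx
      obtain ⟨y, hy, hxy⟩ := mem_compFun.1 hx
      exact mem_compFun.2 ⟨y, φ.mono hb.2.le hy, hxy⟩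
  map_bot := by
    refine Set.Subset.antisymm (fun x hx => ?_)
      (Set.singleton_subset_iff.2 (DeltaIdeal.bot_mem _))
    obtain ⟨y, hy, hxy⟩ := mem_compFun.1 hx
    rw [mem_bot.1 hy] at hxy
    exact mem_bot.1 hxy
  map_sup_le a₁ a₂ b₁ b₂ ha₁ ha₂ hb₁ hb₂ h₁ h₂ x hx := by
    obtain ⟨y, hy, hxy⟩ := mem_compFun.1 hx
    obtain ⟨p, hp, q, hq, hle⟩ := DeltaIdeal.mem_sup.1
      (φ.map_sup_le a₁ a₂ b₁ b₂ ha₁ ha₂ hb₁ hb₂ h₁ h₂ hy)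
    obtain ⟨p', hp', hpp⟩ := DeltaIdeal.exists_mem hp
    obtain ⟨q', hq', hqq⟩ := DeltaIdeal.exists_mem hq
    have hx' := ψ.map_sup_le p q p' q' (DeltaIdeal.mem_bounded hp) (DeltaIdeal.mem_bounded hq)
      (DeltaIdeal.mem_bounded hp') (DeltaIdeal.mem_bounded hq') hpp hqq (ψ.mono hle hxy)
    obtain ⟨r, hr, s, hs, hxrs⟩ := DeltaIdeal.mem_sup.1 hx'
    exact DeltaIdeal.mem_sup.2 ⟨r, mem_compFun.2 ⟨p', hp', hr⟩, s, mem_compFun.2 ⟨q', hq', hs⟩, hxrs⟩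
  exists_mem c hc := by
    obtain ⟨b, hb, h⟩ := ψ.exists_mem c hc
    obtain ⟨a, ha, h'⟩ := φ.exists_mem b hb
    exact ⟨a, ha, mem_compFun.2 ⟨b, h', h⟩⟩

theorem mem_comp {φ : Hom A B} {ψ : Hom B C} {a : A} {x : C} :
    x ∈ comp φ ψ a ↔ ∃ b ∈ φ a, x ∈ ψ b := mem_compFun

end Hom

instance : Category MDHLC.{u} where
  Hom := Hom
  id := Hom.id
  comp := Hom.comp
  id_comp φ := Hom.ext' fun _ _ => by
    rw [Hom.mem_comp, φ.mem_iff]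
    rfl
  comp_id φ := Hom.ext' fun a x => by
    rw [Hom.mem_comp]
    constructor
    · rintro ⟨b, hb, hx⟩
      exact DeltaIdeal.mem_of_le hx.2.le hb
    · intro hx
      obtain ⟨y, hy, hxy⟩ := DeltaIdeal.exists_mem hx
      exact ⟨y, hy, DeltaIdeal.mem_bounded hx, hxy⟩
  assoc φ ψ χ := Hom.ext' fun a x => by
    simp only [Hom.mem_comp]
    constructor
    · rintro ⟨c, ⟨b, hb, hc⟩, hx⟩
      exact ⟨b, hb, c, hc, hx⟩
    · rintro ⟨b, hb, c, hc, hx⟩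
      exact ⟨c, ⟨b, hb, hc⟩, hx⟩

end MDHLC

/-! ### LCA-isomorphisms -/

/-- An LCA-isomorphism: a Boolean (equivalently, order) isomorphism that preserves and reflects
contact and boundedness. -/
structure LCAIso (A B : Type u) [BooleanAlgebra A] [BooleanAlgebra B] [LocalContactAlgebra A]
    [LocalContactAlgebra B] where
  toIso : A ≃o B
  contact_iff : ∀ a b, contact (toIso a) (toIso b) ↔ contact a b
  bounded_iff : ∀ a, toIso a ∈ bounded (A := B) ↔ a ∈ bounded (A := A)

namespace LCAIso

variable {A B : MDHLC.{u}}

theorem wellInside_iff (e : LCAIso A B) {a b : A} : e.toIso a ≪ e.toIso b ↔ a ≪ b := by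
  have h := e.contact_iff a bᶜ
  rw [map_compl e.toIso b] at h
  exact not_congr h

/-- The `MDHLC`-morphism `a ↦ I_{e(a)}` induced by an LCA-isomorphism `e`. -/
def tilde (e : LCAIso A B) : A ⟶ B :=
  MDHLC.Hom.ofMem (fun a => DeltaIdeal.principal (e.toIso a))
    (fun _ _ h _ hx => ⟨hx.1, hx.2.mono le_rfl (e.toIso.monotone h)⟩)
    (fun a b x hx hy => ⟨hx.1, by
      rw [map_inf e.toIso]
      exact (hx.2.inf hy.2).mono (le_inf le_rfl le_rfl) le_rfl⟩)
    (fun a x hx => by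
      obtain ⟨y, hy, hxy, hya⟩ := hx.2.interp hx.1
      obtain ⟨c, rfl⟩ := e.toIso.surjective y
      exact ⟨c, (e.bounded_iff c).1 hy, e.wellInside_iff.1 hya, hx.1, hxy⟩)
    (fun x hx => le_bot_iff.1 (by simpa using hx.2.le))
    (fun a₁ a₂ b₁ b₂ h₁ h₂ x hx =>
      ⟨x ⊓ e.toIso a₁, ⟨Order.Ideal.lower _ inf_le_left hx.1,
          (e.wellInside_iff.2 h₁).mono inf_le_right le_rfl⟩,
        x ⊓ e.toIso a₂, ⟨Order.Ideal.lower _ inf_le_left hx.1,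
          (e.wellInside_iff.2 h₂).mono inf_le_right le_rfl⟩, by
          rw [← inf_sup_left, ← map_sup e.toIso]
          exact le_inf le_rfl hx.2.le⟩)
    (fun b hb => by
      obtain ⟨y, hy, h⟩ := exists_wellInside hb
      obtain ⟨a, rfl⟩ := e.toIso.surjective y
      exact ⟨a, (e.bounded_iff a).1 hy, hb, h⟩)

end LCAIso

/-! ### Regular closed sets -/

/-- The regular closed subsets of a topological space. -/
structure RegularClosed (X : Type u) [TopologicalSpace X] where
  carrier : Set X
  closure_interior' : closure (interior carrier) = carrier

namespace RegularClosed

variable {X : Type u} [TopologicalSpace X]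

instance : SetLike (RegularClosed X) X where
  coe F := F.carrier
  coe_injective F G h := by
    cases F
    cases G
    cases h
    rfl

instance : PartialOrder (RegularClosed X) := .ofSetLike (RegularClosed X) X

theorem closure_interior (F : RegularClosed X) : closure (interior (F : Set X)) = F :=
  F.closure_interior'

theorem isClosed (F : RegularClosed X) : IsClosed (F : Set X) := by
  rw [← F.closure_interior]
  exact isClosed_closure

/-- The closure of an open set is regular closed. -/
def ofOpen (U : Set X) (hU : IsOpen U) : RegularClosed X where
  carrier := closure U
  closure_interior' := Set.Subset.antisymm (closure_minimal interior_subset isClosed_closure)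
    (closure_mono (interior_maximal subset_closure hU))

theorem ofOpen_le {U : Set X} {hU : IsOpen U} {F : RegularClosed X} (h : U ⊆ F) :
    ofOpen U hU ≤ F :=
  closure_minimal (s := U) (t := F) h F.isClosed

theorem le_ofOpen {U : Set X} {hU : IsOpen U} {F : RegularClosed X}
    (h : interior (F : Set X) ⊆ U) : F ≤ ofOpen U hU := by
  intro x hx
  have hx' : x ∈ (F : Set X) := hx
  rw [← F.closure_interior] at hx'
  exact closure_mono h hx'

instance : Max (RegularClosed X) where
  max F G :=
    { carrier := (F : Set X) ∪ G
      closure_interior' := Set.Subset.antisymm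
        (closure_minimal interior_subset (F.isClosed.union G.isClosed)) (by
          conv_lhs => rw [← F.closure_interior, ← G.closure_interior, ← closure_union]
          exact closure_mono (Set.union_subset (interior_mono Set.subset_union_left)
            (interior_mono Set.subset_union_right))) }

instance : Min (RegularClosed X) where
  min F G := ofOpen (interior ((F : Set X) ∩ G)) isOpen_interior

instance : Compl (RegularClosed X) where
  compl F := ofOpen (F : Set X)ᶜ F.isClosed.isOpen_compl

instance : Bot (RegularClosed X) where
  bot := { carrier := ∅, closure_interior' := by simp }

instance : Top (RegularClosed X) where
  top := { carrier := Set.univ, closure_interior' := by simp }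

instance : SupSet (RegularClosed X) where
  sSup S :=
    { carrier := closure (⋃ F ∈ S, (F : Set X))
      closure_interior' := Set.Subset.antisymm
        (closure_minimal interior_subset isClosed_closure)
        (closure_minimal (Set.iUnion₂_subset fun F hF => by
          conv_lhs => rw [← F.closure_interior]
          exact closure_mono (interior_mono
            ((Set.subset_biUnion_of_mem (u := fun F : RegularClosed X => (F : Set X)) hF).trans
              subset_closure))) isClosed_closure) }

instance : InfSet (RegularClosed X) where
  sInf S := ofOpen (interior (⋂ F ∈ S, (F : Set X))) isOpen_interior

theorem coe_sup (F G : RegularClosed X) : ((F ⊔ G : RegularClosed X) : Set X) = (F : Set X) ∪ G :=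
  rfl

theorem coe_inf (F G : RegularClosed X) :
    ((F ⊓ G : RegularClosed X) : Set X) = closure (interior ((F : Set X) ∩ G)) := rfl

theorem coe_compl (F : RegularClosed X) : ((Fᶜ : RegularClosed X) : Set X) = closure (F : Set X)ᶜ :=
  rfl

instance : Lattice (RegularClosed X) where
  sup := (· ⊔ ·)
  inf := (· ⊓ ·)
  le_sup_left F G := Set.subset_union_left (s := (F : Set X)) (t := G)
  le_sup_right F G := Set.subset_union_right (s := (F : Set X)) (t := G)
  sup_le F G H h h' := Set.union_subset (s := (F : Set X)) (t := G) (r := H) h h'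
  inf_le_left _ _ := ofOpen_le (interior_subset.trans Set.inter_subset_left)
  inf_le_right _ _ := ofOpen_le (interior_subset.trans Set.inter_subset_right)
  le_inf _ _ _ h h' := le_ofOpen (interior_mono (Set.subset_inter h h'))

/-- The complete Boolean algebra of regular closed sets, with `F ⊔ G = F ∪ G`,
`F ⊓ G = cl (int (F ∩ G))`, and `cl (X \ F)` as the complement of `F`. -/
instance : CompleteBooleanAlgebra (RegularClosed X) where
  le_sup_inf F G H := ofOpen_le (U := interior (((F : Set X) ∪ G) ∩ ((F : Set X) ∪ H))) (by
    intro x hx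
    by_cases hxF : x ∈ (F : Set X)
    · exact Or.inl hxF
    · refine Or.inr (subset_closure ?_)
      refine interior_maximal (t := interior (((F : Set X) ∪ G) ∩ ((F : Set X) ∪ H)) ∩
        (F : Set X)ᶜ) ?_ (isOpen_interior.inter F.isClosed.isOpen_compl) ⟨hx, hxF⟩
      rintro y ⟨hy, hyF⟩
      have hy' := interior_subset hy
      exact ⟨hy'.1.resolve_left hyF, hy'.2.resolve_left hyF⟩)
  inf_compl_le_bot F := ofOpen_le (U := interior ((F : Set X) ∩ closure (F : Set X)ᶜ)) (by
    rw [interior_inter, closure_compl]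
    rintro x ⟨hx, hx'⟩
    exact (interior_subset hx' hx).elim)
  top_le_sup_compl F x _ := by
    by_cases hx : x ∈ (F : Set X)
    · exact Or.inl hx
    · exact Or.inr (subset_closure hx)
  le_top _ _ _ := trivial
  bot_le _ _ h := h.elim
  isLUB_sSup S := ⟨fun F hF => (Set.subset_biUnion_of_mem
      (u := fun F : RegularClosed X => (F : Set X)) hF).trans subset_closure,
    fun G hG => closure_minimal (Set.iUnion₂_subset fun F hF => hG hF) G.isClosed⟩
  isGLB_sInf S := ⟨fun F hF => ofOpen_le (interior_subset.trans (Set.biInter_subset_of_mem hF)),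
    fun G hG => le_ofOpen (interior_mono (Set.subset_iInter₂ fun F hF => hG hF))⟩

theorem ne_bot_iff {F : RegularClosed X} : F ≠ ⊥ ↔ (F : Set X).Nonempty := by
  rw [Set.nonempty_iff_ne_empty]
  exact not_congr (SetLike.coe_set_eq (p := F) (q := ⊥)).symm

/-- The standard contact relation: two regular closed sets are in contact iff they meet. -/
def stdContact (F G : RegularClosed X) : Prop := ((F : Set X) ∩ G).Nonempty

theorem isContact_stdContact : IsContact (stdContact (X := X)) where
  refl_of_ne_bot F hF := by
    obtain ⟨x, hx⟩ := ne_bot_iff.1 hF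
    exact ⟨x, hx, hx⟩
  ne_bot F G := fun ⟨x, hx, hx'⟩ => ⟨ne_bot_iff.2 ⟨x, hx⟩, ne_bot_iff.2 ⟨x, hx'⟩⟩
  symm F G := fun ⟨x, hx, hx'⟩ => ⟨x, hx', hx⟩
  sup_iff F G H := by
    unfold stdContact
    rw [coe_sup, Set.inter_union_distrib_left, Set.union_nonempty]

theorem nonTangential_iff {F G : RegularClosed X} :
    NonTangential stdContact F G ↔ (F : Set X) ⊆ interior (G : Set X) := by
  unfold NonTangential stdContact
  rw [coe_compl, closure_compl, Set.not_nonempty_iff_eq_empty, ← Set.disjoint_iff_inter_eq_empty,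
    Set.disjoint_compl_right_iff_subset]

/-- The ideal of compact regular closed sets. -/
def compacts (X : Type u) [TopologicalSpace X] : Order.Ideal (RegularClosed X) where
  carrier := {F | IsCompact (F : Set X)}
  lower' := fun _ G h hF => IsCompact.of_isClosed_subset hF G.isClosed h
  nonempty' := ⟨⊥, isCompact_empty⟩
  directed' := fun F hF G hG => ⟨F ⊔ G, IsCompact.union hF hG, le_sup_left, le_sup_right⟩

theorem mem_compacts {F : RegularClosed X} : F ∈ compacts X ↔ IsCompact (F : Set X) := Iff.rfl

theorem exists_between [T2Space X] [LocallyCompactSpace X] {K U : Set X} (hK : IsCompact K)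
    (hU : IsOpen U) (h : K ⊆ U) :
    ∃ F : RegularClosed X, F ∈ compacts X ∧ K ⊆ interior (F : Set X) ∧ (F : Set X) ⊆ U := by
  obtain ⟨L, hL, hKL, hLU⟩ := exists_compact_between hK hU h
  have hsub : closure (interior L) ⊆ L := closure_minimal interior_subset hL.isClosed
  exact ⟨ofOpen (interior L) isOpen_interior, hL.of_isClosed_subset isClosed_closure hsub,
    hKL.trans (interior_maximal subset_closure isOpen_interior), hsub.trans hLU⟩

/-- The standard local contact algebra of a locally compact Hausdorff space. -/
instance [T2Space X] [LocallyCompactSpace X] : LocalContactAlgebra (RegularClosed X) where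
  contact := stdContact
  bounded := compacts X
  isContact := isContact_stdContact
  bc1 F H hF h := by
    simp only [nonTangential_iff] at h ⊢
    obtain ⟨G, hG, hFG, hGH⟩ := exists_between hF isOpen_interior h
    exact ⟨G, hG, hFG, hGH⟩
  bc2 F G := by
    rintro ⟨x, hxF, hxG⟩
    obtain ⟨K, hK, hxK, -⟩ := exists_between (isCompact_singleton (x := x)) isOpen_univ
      (Set.subset_univ _)
    refine ⟨K, hK, x, hxF, ?_⟩
    rw [coe_inf, interior_inter]
    have hxG' : x ∈ closure (interior (G : Set X)) := by
      rw [G.closure_interior]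
      exact hxG
    exact isOpen_interior.inter_closure ⟨hxK rfl, hxG'⟩
  bc3 F hF := by
    have hne : (interior (F : Set X)).Nonempty := by
      rw [← closure_nonempty_iff, F.closure_interior]
      exact ne_bot_iff.1 hF
    obtain ⟨x, hx⟩ := hne
    obtain ⟨K, hK, hxK, hKF⟩ := exists_between (isCompact_singleton (x := x)) isOpen_interior
      (Set.singleton_subset_iff.2 hx)
    exact ⟨K, hK, ne_bot_iff.2 ⟨x, interior_subset (hxK rfl)⟩, nonTangential_iff.2 hKF⟩

theorem wellInside_iff [T2Space X] [LocallyCompactSpace X] {F G : RegularClosed X} :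
    F ≪ G ↔ (F : Set X) ⊆ interior (G : Set X) := nonTangential_iff

end RegularClosed

/-! ### The category `HLC` and the functor `Δᵗ` -/

/-- Locally compact Hausdorff spaces. -/
def isHLC : ObjectProperty TopCat.{u} := fun X => T2Space X ∧ LocallyCompactSpace X

/-- The category of locally compact Hausdorff spaces and continuous maps. -/
abbrev HLC : Type (u + 1) := isHLC.{u}.FullSubcategory

namespace HLC

instance (X : HLC.{u}) : T2Space X.obj := X.property.1

instance (X : HLC.{u}) : LocallyCompactSpace X.obj := X.property.2

end HLC

/-- The complete local contact algebra of regular closed subsets of `X`. -/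
abbrev psiT (X : HLC.{u}) : MDHLC.{u} := ⟨RegularClosed X.obj⟩

/-- The δ-ideal `{F ∈ CR(X) | F ⊆ f⁻¹(int G)}`. -/
def phiFun {X Y : HLC.{u}} (f : X ⟶ Y) (G : psiT Y) : DeltaIdeal (psiT X) :=
  DeltaIdeal.ofSet (A := RegularClosed X.obj)
    {F : RegularClosed X.obj | F ∈ RegularClosed.compacts X.obj ∧
      (F : Set X.obj) ⊆ f.hom ⁻¹' interior (G : RegularClosed Y.obj).carrier}
    ⟨isCompact_empty, Set.empty_subset _⟩
    (fun _ _ h hF => ⟨Order.Ideal.lower _ h hF.1, fun _ hx => hF.2 (h hx)⟩)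
    (fun _ _ hF hG => ⟨Order.Ideal.sup_mem hF.1 hG.1, Set.union_subset hF.2 hG.2⟩)
    (fun _ hF => hF.1)
    (fun F hF => by
      obtain ⟨K, hK, hFK, hKU⟩ := RegularClosed.exists_between (RegularClosed.mem_compacts.1 hF.1)
        (isOpen_interior.preimage f.hom.hom.continuous) hF.2
      exact ⟨K, ⟨hK, hKU⟩, RegularClosed.wellInside_iff.2 hFK⟩)

theorem mem_phiFun {X Y : HLC.{u}} {f : X ⟶ Y} {G : RegularClosed Y.obj}
    {F : RegularClosed X.obj} : F ∈ (phiFun f G : DeltaIdeal (RegularClosed X.obj)) ↔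
      IsCompact (F : Set X.obj) ∧ (F : Set X.obj) ⊆ f.hom ⁻¹' interior (G : Set Y.obj) := Iff.rfl

/-- The morphism `φ_f : Ψᵗ(Y) ⟶ Ψᵗ(X)`, `φ_f(G) = {F ∈ CR(X) | F ⊆ f⁻¹(int G)}`. -/
def phi {X Y : HLC.{u}} (f : X ⟶ Y) : psiT Y ⟶ psiT X :=
  MDHLC.Hom.ofMem (phiFun f)
    (fun _ _ h _ hF => ⟨hF.1, hF.2.trans (Set.preimage_mono (interior_mono h))⟩)
    (fun G H F hF hF' => ⟨hF.1, fun x hx => by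
      refine interior_maximal subset_closure isOpen_interior ?_
      rw [interior_inter]
      exact ⟨hF.2 hx, hF'.2 hx⟩⟩)
    (fun G F hF => by
      obtain ⟨K, hK, hFK, hKG⟩ := RegularClosed.exists_between
        ((RegularClosed.mem_compacts.1 hF.1).image f.hom.hom.continuous) isOpen_interior
        (Set.image_subset_iff.2 hF.2)
      exact ⟨K, hK, RegularClosed.wellInside_iff.2 hKG, hF.1, Set.image_subset_iff.1 hFK⟩)
    (fun F hF => by
      refine le_bot_iff.1 (show F ≤ ⊥ from fun x hx => ?_)
      exact interior_subset (s := (∅ : Set Y.obj)) (hF.2 hx))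
    (fun G₁ G₂ H₁ H₂ h₁ h₂ F hF => by
      have h₁' := RegularClosed.wellInside_iff.1 h₁
      have h₂' := RegularClosed.wellInside_iff.1 h₂
      obtain ⟨K₁, K₂, hK₁, hK₂, hKH₁, hKH₂, hK⟩ :=
        (RegularClosed.mem_compacts.1 hF.1).binary_compact_cover
          (isOpen_interior.preimage f.hom.hom.continuous)
          (isOpen_interior.preimage f.hom.hom.continuous)
          (show (F : RegularClosed X.obj).carrier ⊆
              f.hom ⁻¹' interior (H₁ : RegularClosed Y.obj).carrier ∪
              f.hom ⁻¹' interior (H₂ : RegularClosed Y.obj).carrier from fun x hx =>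
            (interior_subset (hF.2 hx)).elim (fun h => Or.inl (h₁' h)) (fun h => Or.inr (h₂' h)))
      obtain ⟨L₁, hL₁, hKL₁, hLU₁⟩ := RegularClosed.exists_between hK₁
        (isOpen_interior.preimage f.hom.hom.continuous) hKH₁
      obtain ⟨L₂, hL₂, hKL₂, hLU₂⟩ := RegularClosed.exists_between hK₂
        (isOpen_interior.preimage f.hom.hom.continuous) hKH₂
      refine ⟨L₁, ⟨hL₁, hLU₁⟩, L₂, ⟨hL₂, hLU₂⟩, ?_⟩
      have : (F : RegularClosed X.obj).carrier ⊆ L₁.carrier ∪ L₂.carrier := by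
        have hK' : (F : RegularClosed X.obj).carrier = K₁ ∪ K₂ := hK
        rw [hK']
        exact Set.union_subset_union (hKL₁.trans interior_subset) (hKL₂.trans interior_subset)
      exact this)
    (fun F hF => by
      obtain ⟨K, hK, hFK, -⟩ := RegularClosed.exists_between
        ((RegularClosed.mem_compacts.1 hF).image f.hom.hom.continuous) isOpen_univ
        (Set.subset_univ _)
      exact ⟨K, hK, hF, Set.image_subset_iff.1 hFK⟩)

/-- The contravariant functor `Δᵗ : HLC ⟶ MDHLC`. -/
def DeltaT : HLC.{u}ᵒᵖ ⥤ MDHLC.{u} where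
  obj X := psiT X.unop
  map f := phi f.unop
  map_id X := MDHLC.Hom.ext' fun G F =>
    and_congr_right fun _ => (RegularClosed.wellInside_iff (F := F) (G := G)).symm
  map_comp {X Y Z} f g := MDHLC.Hom.ext' fun G F => by
    refine Iff.trans ?_ MDHLC.Hom.mem_comp.symm
    constructor
    · intro hF
      obtain ⟨K, hK, hFK, hKG⟩ := RegularClosed.exists_between
        ((RegularClosed.mem_compacts.1 hF.1).image g.unop.hom.hom.continuous)
        (isOpen_interior.preimage f.unop.hom.hom.continuous)
        (Set.image_subset_iff.2 hF.2)
      exact ⟨K, ⟨hK, hKG⟩, hF.1, Set.image_subset_iff.1 hFK⟩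
    · rintro ⟨K, hK, hF⟩
      exact ⟨hF.1, fun x hx => hK.2 (interior_subset (hF.2 hx))⟩

/-! ### Clusters and the functor `Δᵃ` -/

/-- The Alexandroff extension `C_ρ` of the contact relation of a local contact algebra. -/
def alexandroff {A : Type u} [BooleanAlgebra A] [LocalContactAlgebra A] (a b : A) : Prop :=
  contact a b ∨ (a ∉ bounded (A := A) ∧ b ∉ bounded (A := A))

/-- `σ` is a cluster with respect to the relation `C`. -/
structure IsCluster {A : Type u} [BooleanAlgebra A] (C : A → A → Prop) (σ : Set A) : Prop where
  nonempty : σ.Nonempty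
  contact_of_mem : ∀ a b, a ∈ σ → b ∈ σ → C a b
  mem_or_mem : ∀ a b, a ⊔ b ∈ σ → a ∈ σ ∨ b ∈ σ
  mem_of_contact : ∀ a, (∀ b ∈ σ, C a b) → a ∈ σ

/-- The clusters of a local contact algebra `(A, ρ, 𝔹)`, i.e. of the contact algebra `(A, C_ρ)`. -/
def Clust (A : Type u) [BooleanAlgebra A] [LocalContactAlgebra A] : Type u :=
  {σ : Set A // IsCluster alexandroff σ}

/-- The topology on clusters having the sets `λ(a) = {σ | a ∈ σ}` as a base of closed sets. -/
instance (A : Type u) [BooleanAlgebra A] [LocalContactAlgebra A] : TopologicalSpace (Clust A) :=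
  TopologicalSpace.generateFrom (Set.range fun a : A => {σ : Clust A | a ∈ σ.1}ᶜ)

/-- The space `Ψᵃ(A, ρ, 𝔹)` of bounded clusters, as a subspace of the space of clusters. If
`1 ∈ 𝔹` then every cluster is bounded; otherwise the only cluster that is not bounded is `A \ 𝔹`. -/
def BClust (A : Type u) [BooleanAlgebra A] [LocalContactAlgebra A] : Type u :=
  {σ : Clust A // ∃ b ∈ σ.1, b ∈ bounded (A := A)}

instance (A : Type u) [BooleanAlgebra A] [LocalContactAlgebra A] : TopologicalSpace (BClust A) :=
  inferInstanceAs (TopologicalSpace {σ : Clust A // ∃ b ∈ σ.1, b ∈ bounded (A := A)})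

/-- The underlying set of elements of a bounded cluster. -/
def BClust.elems {A : Type u} [BooleanAlgebra A] [LocalContactAlgebra A] (σ : BClust A) : Set A :=
  σ.1.1

section Clusters

variable {A : Type u} [BooleanAlgebra A] [LocalContactAlgebra A]

theorem alexandroff_symm {a b : A} (h : alexandroff a b) : alexandroff b a :=
  h.imp contact_symm And.symm

theorem alexandroff_mono {a b c d : A} (hac : a ≤ c) (hbd : b ≤ d) (h : alexandroff a b) :
    alexandroff c d :=
  h.imp (contact_mono hac hbd) fun h =>
    ⟨fun hc => h.1 (Order.Ideal.lower _ hac hc), fun hd => h.2 (Order.Ideal.lower _ hbd hd)⟩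

theorem alexandroff_sup {a b c : A} (h : alexandroff a (b ⊔ c)) :
    alexandroff a b ∨ alexandroff a c := by
  rcases h with h | ⟨ha, hbc⟩
  · exact (contact_sup.1 h).imp Or.inl Or.inl
  · by_cases hb : b ∈ bounded (A := A)
    · exact Or.inr (Or.inr ⟨ha, fun hc => hbc (Order.Ideal.sup_mem hb hc)⟩)
    · exact Or.inl (Or.inr ⟨ha, hb⟩)

theorem not_alexandroff_of_wellInside {a b : A} (ha : a ∈ bounded (A := A)) (h : a ≪ b) :
    ¬ alexandroff a bᶜ := by
  rintro (h' | h')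
  exacts [h h', h'.1 ha]

/-- The interpolation axiom (C5) of the Alexandroff extension. -/
theorem exists_not_alexandroff {a b : A} (h : ¬ alexandroff a b) :
    ∃ c, ¬ alexandroff a c ∧ ¬ alexandroff b cᶜ := by
  have hab : ¬ contact a b := fun h' => h (Or.inl h')
  by_cases ha : a ∈ bounded (A := A)
  · have hw : a ≪ bᶜ := fun h' => hab (by rwa [compl_compl] at h')
    obtain ⟨c, hc, hac, hcb⟩ := hw.interp ha
    refine ⟨cᶜ, not_alexandroff_of_wellInside ha hac, ?_⟩
    have := not_alexandroff_of_wellInside hc hcb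
    rw [compl_compl] at this ⊢
    exact fun h' => this (alexandroff_symm h')
  · have hb : b ∈ bounded (A := A) := by
      by_contra hb
      exact h (Or.inr ⟨ha, hb⟩)
    have hw : b ≪ aᶜ := fun h' => hab (by
      rw [compl_compl] at h'
      exact contact_symm h')
    obtain ⟨c, hc, hbc, hca⟩ := hw.interp hb
    refine ⟨c, ?_, not_alexandroff_of_wellInside hb hbc⟩
    have := not_alexandroff_of_wellInside hc hca
    rw [compl_compl] at this
    exact fun h' => this (alexandroff_symm h')

variable {σ : Set A}

theorem IsCluster.mono (hσ : IsCluster alexandroff σ) {a b : A} (hab : a ≤ b) (ha : a ∈ σ) :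
    b ∈ σ :=
  hσ.mem_of_contact b fun c hc => alexandroff_mono hab le_rfl (hσ.contact_of_mem a c ha hc)

theorem IsCluster.top_mem (hσ : IsCluster alexandroff σ) : ⊤ ∈ σ := by
  obtain ⟨a, ha⟩ := hσ.nonempty
  exact hσ.mono le_top ha

theorem IsCluster.bot_notMem (hσ : IsCluster alexandroff σ) : ⊥ ∉ σ := fun h => by
  rcases hσ.contact_of_mem _ _ h h with h' | h'
  exacts [not_contact_bot _ h', h'.1 (Order.Ideal.bot_mem _)]

theorem IsCluster.mem_of_compl_notMem (hσ : IsCluster alexandroff σ) {a : A} (h : aᶜ ∉ σ) :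
    a ∈ σ := by
  have := hσ.top_mem
  rw [← sup_compl_eq_top (x := a)] at this
  exact (hσ.mem_or_mem _ _ this).resolve_right h

theorem IsCluster.compl_notMem (hσ : IsCluster alexandroff σ) {a b : A}
    (hb : a ∈ bounded (A := A)) (ha : a ∈ σ) (h : a ≪ b) : bᶜ ∉ σ := fun h' =>
  not_alexandroff_of_wellInside hb h (hσ.contact_of_mem _ _ ha h')

/-- A prime, pairwise contacting family generates a cluster. -/
theorem isCluster_of_clan {p : Set A} (htop : ⊤ ∈ p)
    (hprime : ∀ a b, a ⊔ b ∈ p → a ∈ p ∨ b ∈ p)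
    (hcontact : ∀ a b, a ∈ p → b ∈ p → alexandroff a b) :
    IsCluster alexandroff {a | ∀ b ∈ p, alexandroff a b} where
  nonempty := ⟨⊤, fun b hb => hcontact _ _ htop hb⟩
  contact_of_mem a b ha hb := by
    by_contra h
    obtain ⟨c, hac, hbc⟩ := exists_not_alexandroff h
    rw [← sup_compl_eq_top (x := c)] at htop
    rcases hprime _ _ htop with h' | h'
    exacts [hac (ha c h'), hbc (hb _ h')]
  mem_or_mem a b hab := by
    have key : ∀ a : A, (∃ x ∈ p, ¬ alexandroff a x) → ∃ c, ¬ alexandroff a c ∧ cᶜ ∉ p := by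
      rintro a ⟨x, hx, hax⟩
      obtain ⟨c, hac, hxc⟩ := exists_not_alexandroff hax
      exact ⟨c, hac, fun h => hxc (hcontact _ _ hx h)⟩
    by_contra h
    simp only [Set.mem_ofPred_eq, not_or, not_forall, exists_prop] at h
    obtain ⟨c, hac, hc⟩ := key a h.1
    obtain ⟨d, hbd, hd⟩ := key b h.2
    have hcd : c ⊓ d ∈ p := by
      rw [← sup_compl_eq_top (x := c ⊓ d), compl_inf] at htop
      exact (hprime _ _ htop).resolve_right fun h => (hprime _ _ h).elim hc hd
    rcases alexandroff_sup (alexandroff_symm (hab _ hcd)) with h' | h'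
    · exact hac (alexandroff_mono le_rfl inf_le_left (alexandroff_symm h'))
    · exact hbd (alexandroff_mono le_rfl inf_le_right (alexandroff_symm h'))
  mem_of_contact a ha b hb := ha b fun c hc => hcontact _ _ hb hc

theorem Clust.isOpen_notMem (a : A) : IsOpen {σ : Clust A | a ∉ σ.1} :=
  TopologicalSpace.isOpen_generateFrom_of_mem ⟨a, rfl⟩

instance : T2Space (Clust A) := by
  have key : ∀ σ τ : Clust A, ∀ a, a ∈ σ.1 → a ∉ τ.1 →
      ∃ U V : Set (Clust A), IsOpen U ∧ IsOpen V ∧ σ ∈ U ∧ τ ∈ V ∧ Disjoint U V := by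
    intro σ τ a ha ha'
    have : ∃ b ∈ τ.1, ¬ alexandroff a b := by
      by_contra! h
      exact ha' (τ.2.mem_of_contact a h)
    obtain ⟨b, hb, hab⟩ := this
    obtain ⟨c, hac, hbc⟩ := exists_not_alexandroff hab
    refine ⟨_, _, Clust.isOpen_notMem c, Clust.isOpen_notMem cᶜ,
      fun h => hac (σ.2.contact_of_mem _ _ ha h), fun h => hbc (τ.2.contact_of_mem _ _ hb h), ?_⟩
    rw [Set.disjoint_left]
    exact fun ν h h' => h (ν.2.mem_of_compl_notMem h')
  refine ⟨fun σ τ hne => ?_⟩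
  by_cases h : σ.1 ⊆ τ.1
  · have h' : ¬ τ.1 ⊆ σ.1 := fun h' => hne (Subtype.ext (Set.Subset.antisymm h h'))
    obtain ⟨a, ha, ha'⟩ := Set.not_subset.1 h'
    obtain ⟨U, V, hU, hV, hτ, hσ, hd⟩ := key τ σ a ha ha'
    exact ⟨V, U, hV, hU, hσ, hτ, hd.symm⟩
  · obtain ⟨a, ha, ha'⟩ := Set.not_subset.1 h
    exact key σ τ a ha ha'

instance : CompactSpace (Clust A) := by
  refine ⟨isCompact_iff_ultrafilter_le_nhds.2 fun F _ => ?_⟩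
  let p : Set A := {a | {σ : Clust A | a ∈ σ.1} ∈ F}
  have hp : ∀ a b, a ∈ p → b ∈ p → alexandroff a b := by
    intro a b ha hb
    obtain ⟨σ, h, h'⟩ := F.neBot.nonempty_of_mem (Filter.inter_mem ha hb)
    exact σ.2.contact_of_mem _ _ h h'
  have hc := isCluster_of_clan (p := p)
    (Filter.mem_of_superset Filter.univ_mem fun σ _ => σ.2.top_mem)
    (fun a b h => Ultrafilter.union_mem_iff.1
      (Filter.mem_of_superset h fun σ h => σ.2.mem_or_mem _ _ h)) hp
  let τ : Clust A := ⟨_, hc⟩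
  refine ⟨τ, Set.mem_univ τ, ?_⟩
  rw [TopologicalSpace.nhds_generateFrom]
  refine le_iInf₂ fun U hU => ?_
  obtain ⟨hmem, a, rfl⟩ := hU
  rw [Filter.le_principal_iff]
  exact Ultrafilter.compl_mem_iff_notMem.2 fun ha => hmem fun b hb => hp a b ha hb

instance : T2Space (BClust A) :=
  inferInstanceAs (T2Space {σ : Clust A // ∃ b ∈ σ.1, b ∈ bounded (A := A)})

instance : LocallyCompactSpace (BClust A) := by
  have h : IsOpen {σ : Clust A | ∃ b ∈ σ.1, b ∈ bounded (A := A)} := by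
    refine isOpen_iff_forall_mem_open.2 fun σ ⟨b, hb, hbB⟩ => ?_
    obtain ⟨c, hc, hbc⟩ := exists_wellInside hbB
    exact ⟨_, fun τ hτ => ⟨c, τ.2.mem_of_compl_notMem hτ, hc⟩, Clust.isOpen_notMem cᶜ,
      σ.2.compl_notMem hbB hb hbc⟩
  exact h.locallyCompactSpace

namespace BClust

theorem isCluster (σ : BClust A) : IsCluster alexandroff σ.elems := σ.1.2

theorem ext {σ τ : BClust A} (h : ∀ a, a ∈ σ.elems ↔ a ∈ τ.elems) : σ = τ :=
  Subtype.ext (Subtype.ext (Set.ext h))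

theorem isOpen_notMem (a : A) : IsOpen {σ : BClust A | a ∉ σ.elems} :=
  (Clust.isOpen_notMem a).preimage continuous_subtype_val

theorem exists_bounded_le (σ : BClust A) {a : A} (ha : a ∈ σ.elems) :
    ∃ b ∈ σ.elems, b ∈ bounded (A := A) ∧ b ≤ a := by
  obtain ⟨e, he, heB⟩ := σ.2
  obtain ⟨c, hc, hec⟩ := exists_wellInside heB
  refine ⟨a ⊓ c, ?_, Order.Ideal.lower _ inf_le_right hc, inf_le_left⟩
  have hac : a ⊓ c ⊔ a ⊓ cᶜ ∈ σ.elems := by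
    rw [← inf_sup_left, sup_compl_eq_top, inf_top_eq]
    exact ha
  exact (σ.isCluster.mem_or_mem _ _ hac).resolve_right fun h =>
    σ.isCluster.compl_notMem heB he hec (σ.isCluster.mono inf_le_right h)

/-- A bounded cluster is determined by its bounded elements. -/
theorem eq_of_inter_bounded {σ τ : BClust A}
    (h : ∀ a ∈ bounded (A := A), a ∈ σ.elems ↔ a ∈ τ.elems) : σ = τ := by
  refine ext fun a => ⟨fun ha => ?_, fun ha => ?_⟩
  · obtain ⟨b, hb, hbB, hba⟩ := σ.exists_bounded_le ha
    exact τ.isCluster.mono hba ((h b hbB).1 hb)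
  · obtain ⟨b, hb, hbB, hba⟩ := τ.exists_bounded_le ha
    exact σ.isCluster.mono hba ((h b hbB).2 hb)

theorem inf_mem {I J : DeltaIdeal A} (σ : BClust A) {x y : A} (hx : x ∈ I) (hxσ : x ∈ σ.elems)
    (hy : y ∈ J) (hyσ : y ∈ σ.elems) : ∃ z ∈ I ⊓ J, z ∈ σ.elems := by
  obtain ⟨l, hl, hxl⟩ := DeltaIdeal.exists_mem hx
  obtain ⟨m, hm, hym⟩ := DeltaIdeal.exists_mem hy
  refine ⟨l ⊓ m, ⟨DeltaIdeal.mem_of_le inf_le_left hl, DeltaIdeal.mem_of_le inf_le_right hm⟩,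
    σ.isCluster.mem_of_compl_notMem ?_⟩
  rw [compl_inf]
  exact fun h => (σ.isCluster.mem_or_mem _ _ h).elim
    (σ.isCluster.compl_notMem (DeltaIdeal.mem_bounded hx) hxσ hxl)
    (σ.isCluster.compl_notMem (DeltaIdeal.mem_bounded hy) hyσ hym)

end BClust

end Clusters

section Pullback

variable {A B : MDHLC.{u}}

theorem meets_or_meets (φ : A ⟶ B) (σ : BClust B) {a b : A} (ha : a ∈ bounded (A := A))
    (hab : a ≪ b) : (∃ x ∈ φ.toFun b, x ∈ σ.elems) ∨ (∃ x ∈ φ.toFun aᶜ, x ∈ σ.elems) := by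
  obtain ⟨x, hx, hxB⟩ := σ.2
  obtain ⟨e, he, hxe⟩ := φ.exists_mem x hxB
  obtain ⟨c, hc, hac, hcb⟩ := hab.interp ha
  obtain ⟨d, hd, hcd, hdb⟩ := hcb.interp hc
  have heB : e ⊓ cᶜ ∈ bounded (A := A) := Order.Ideal.lower _ inf_le_left he
  obtain ⟨g, hg, heg, hga⟩ := (hac.compl.mono (inf_le_right (a := e)) le_rfl).interp heB
  have hle : e ≤ c ⊔ e ⊓ cᶜ := by
    rw [sup_inf_left, sup_compl_eq_top, inf_top_eq]
    exact le_sup_right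
  obtain ⟨y, hy, z, hz, hxyz⟩ := DeltaIdeal.mem_sup.1
    (φ.map_sup_le _ _ _ _ hc heB hd hg hcd heg (φ.mono hle hxe))
  rcases σ.isCluster.mem_or_mem _ _ (σ.isCluster.mono hxyz hx) with h | h
  · exact Or.inl ⟨y, φ.mono hdb.le hy, h⟩
  · exact Or.inr ⟨z, φ.mono hga.le hz, h⟩

theorem not_meets_compl (φ : A ⟶ B) (σ : BClust B) {a : A} {x y : B} (hx : x ∈ φ.toFun a)
    (hxσ : x ∈ σ.elems) (hy : y ∈ φ.toFun aᶜ) (hyσ : y ∈ σ.elems) : False := by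
  obtain ⟨z, hz, hzσ⟩ := σ.inf_mem hx hxσ hy hyσ
  rw [← φ.map_inf, inf_compl_eq_bot] at hz
  rw [MDHLC.Hom.mem_bot.1 hz] at hzσ
  exact σ.isCluster.bot_notMem hzσ

theorem isCluster_pullback (φ : A ⟶ B) (σ : BClust B) :
    IsCluster alexandroff {a : A | ∀ x ∈ φ.toFun aᶜ, x ∉ σ.elems} where
  nonempty := ⟨⊤, fun x hx => by
    rw [compl_top] at hx
    rw [MDHLC.Hom.mem_bot.1 hx]
    exact σ.isCluster.bot_notMem⟩
  contact_of_mem := by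
    have key : ∀ a b : A, a ∈ bounded (A := A) → ¬ contact a b →
        (∀ x ∈ φ.toFun aᶜ, x ∉ σ.elems) → (∀ x ∈ φ.toFun bᶜ, x ∉ σ.elems) → False := by
      intro a b haB hab ha hb
      have hw : a ≪ bᶜ := fun h' => hab (by rwa [compl_compl] at h')
      rcases meets_or_meets φ σ haB hw with ⟨x, hx, hxσ⟩ | ⟨x, hx, hxσ⟩
      exacts [hb x hx hxσ, ha x hx hxσ]
    intro a b ha hb
    by_contra h
    have hab : ¬ contact a b := fun h' => h (Or.inl h')
    by_cases haB : a ∈ bounded (A := A)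
    · exact key a b haB hab ha hb
    · by_cases hbB : b ∈ bounded (A := A)
      · exact key b a hbB (fun h' => hab (contact_symm h')) hb ha
      · exact h (Or.inr ⟨haB, hbB⟩)
  mem_or_mem a b hab := by
    by_contra h
    simp only [Set.mem_ofPred_eq, not_or, not_forall, not_not, exists_prop] at h
    obtain ⟨⟨x, hx, hxσ⟩, ⟨y, hy, hyσ⟩⟩ := h
    obtain ⟨z, hz, hzσ⟩ := σ.inf_mem hx hxσ hy hyσ
    rw [← φ.map_inf, ← compl_sup] at hz
    exact hab z hz hzσ
  mem_of_contact a ha x hx hxσ := by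
    obtain ⟨b, ⟨hbB, hba⟩, hxb⟩ := φ.mem_iff.1 hx
    refine not_alexandroff_of_wellInside hbB hba ?_
    rw [compl_compl]
    exact alexandroff_symm (ha b fun y hy hyσ => not_meets_compl φ σ hxb hxσ hy hyσ)

theorem exists_pullback (φ : A ⟶ B) (σ : BClust B) :
    ∃ τ : BClust A, ∀ a, a ∈ τ.elems ↔ ∀ x ∈ φ.toFun aᶜ, x ∉ σ.elems := by
  refine ⟨⟨⟨_, isCluster_pullback φ σ⟩, ?_⟩, fun a => Iff.rfl⟩
  obtain ⟨x, hx, hxB⟩ := σ.2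
  obtain ⟨e, he, hxe⟩ := φ.exists_mem x hxB
  exact ⟨e, fun y hy hyσ => not_meets_compl φ σ hxe hx hy hyσ, he⟩

theorem pullback_aux (φ : A ⟶ B) (σ : BClust B) {a : A} (ha : a ∈ bounded (A := A)) :
    (∀ x ∈ φ.toFun aᶜ, x ∉ σ.elems) ↔
      ∀ b : A, a ≪ b → ((φ.toFun b : Set B) ∩ σ.elems).Nonempty := by
  constructor
  · intro h b hab
    rcases meets_or_meets φ σ ha hab with ⟨x, hx, hxσ⟩ | ⟨x, hx, hxσ⟩
    exacts [⟨x, hx, hxσ⟩, (h x hx hxσ).elim]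
  · intro h x hx hxσ
    obtain ⟨c, ⟨hcB, hca⟩, hxc⟩ := φ.mem_iff.1 hx
    have hac := hca.compl
    rw [compl_compl] at hac
    obtain ⟨y, hy, hyσ⟩ := h _ hac
    exact not_meets_compl φ σ hxc hxσ hy hyσ

/-- For every `MDHLC`-morphism `φ : A ⟶ B` and every `σ' ∈ Ψᵃ(B)` there is exactly one `σ ∈ Ψᵃ(A)`
with `σ ∩ 𝔹 = {a ∈ 𝔹 | ∀ b ∈ A, a ≪ b → φ(b) ∩ σ' ≠ ∅}`. -/
theorem existsUnique_pullback (φ : A ⟶ B) (σ' : BClust B) :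
    ∃! σ : BClust A, σ.elems ∩ {a | a ∈ bounded (A := A)} =
      {a | a ∈ bounded (A := A) ∧
        ∀ b : A, a ≪ b → ((φ.toFun b : Set B) ∩ σ'.elems).Nonempty} := by
  obtain ⟨τ, hτ⟩ := exists_pullback φ σ'
  refine ⟨τ, Set.ext fun a => ⟨fun h => ⟨h.2, ?_⟩, fun h => ⟨?_, h.1⟩⟩, fun ν hν => ?_⟩
  · exact (pullback_aux φ σ' h.2).1 ((hτ a).1 h.1)
  · exact (hτ a).2 ((pullback_aux φ σ' h.1).2 h.2)
  · refine BClust.eq_of_inter_bounded fun a ha => ?_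
    have h := Set.ext_iff.1 hν a
    rw [hτ a, pullback_aux φ σ' ha]
    exact ⟨fun h' => (h.1 ⟨h', ha⟩).2, fun h' => (h.2 ⟨ha, h'⟩).1⟩

/-- The map `f_φ : Ψᵃ(B) → Ψᵃ(A)` of an `MDHLC`-morphism `φ : A ⟶ B`: `f_φ(σ')` is the unique
`σ ∈ Ψᵃ(A)` with `σ ∩ 𝔹 = {a ∈ 𝔹 | ∀ b ∈ A, a ≪ b → φ(b) ∩ σ' ≠ ∅}`. -/
noncomputable def pullback (φ : A ⟶ B) (σ' : BClust B) : BClust A :=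
  (existsUnique_pullback φ σ').choose

theorem mem_pullback {φ : A ⟶ B} {σ' : BClust B} {a : A} :
    a ∈ (pullback φ σ').elems ↔ ∀ x ∈ φ.toFun aᶜ, x ∉ σ'.elems := by
  obtain ⟨τ, hτ⟩ := exists_pullback φ σ'
  have h : pullback φ σ' = τ := by
    have hp := (existsUnique_pullback φ σ').choose_spec.1
    refine BClust.eq_of_inter_bounded fun a ha => ?_
    have h := Set.ext_iff.1 hp a
    rw [hτ a, pullback_aux φ σ' ha]
    exact ⟨fun h' => (h.1 ⟨h', ha⟩).2, fun h' => (h.2 ⟨ha, h'⟩).1⟩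
  rw [h, hτ a]

theorem continuous_pullback (φ : A ⟶ B) : Continuous (pullback φ) := by
  have h1 : Continuous fun σ' : BClust B => (pullback φ σ').1 := by
    refine continuous_generateFrom_iff.2 ?_
    rintro _ ⟨a, rfl⟩
    refine isOpen_iff_forall_mem_open.2 fun σ hσ => ?_
    have hσ' : ¬ a ∈ (pullback φ σ).elems := hσ
    rw [mem_pullback] at hσ'
    push Not at hσ'
    obtain ⟨x, hx, hxσ⟩ := hσ'
    obtain ⟨y, hy, hxy⟩ := DeltaIdeal.exists_mem hx
    refine ⟨_, fun τ hτ => ?_, BClust.isOpen_notMem yᶜ,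
      σ.isCluster.compl_notMem (DeltaIdeal.mem_bounded hx) hxσ hxy⟩
    intro h
    exact mem_pullback.1 h y hy (τ.isCluster.mem_of_compl_notMem hτ)
  exact continuous_induced_rng.2 h1

theorem pullback_id (σ : BClust A) : pullback (𝟙 A) σ = σ := by
  refine BClust.ext fun a => ?_
  rw [mem_pullback]
  constructor
  · intro h
    by_contra ha
    have : ∃ b ∈ σ.elems, ¬ alexandroff a b := by
      by_contra! h'
      exact ha (σ.isCluster.mem_of_contact a h')
    obtain ⟨b, hb, hab⟩ := this
    obtain ⟨c, hc, hcB, hcb⟩ := σ.exists_bounded_le hb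
    refine h c ⟨hcB, fun h' => hab (Or.inl ?_)⟩ hc
    rw [compl_compl] at h'
    exact contact_symm (contact_mono hcb le_rfl h')
  · intro ha x hx hxσ
    have := σ.isCluster.compl_notMem hx.1 hxσ hx.2
    rw [compl_compl] at this
    exact this ha

theorem pullback_comp {C : MDHLC.{u}} (φ : A ⟶ B) (ψ : B ⟶ C) (σ : BClust C) :
    pullback (φ ≫ ψ) σ = pullback φ (pullback ψ σ) := by
  refine BClust.ext fun a => ?_
  rw [mem_pullback, mem_pullback]
  constructor
  · intro h c hc hcσ
    rw [mem_pullback] at hcσ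
    obtain ⟨d, hd, hcd⟩ := DeltaIdeal.exists_mem hc
    rcases meets_or_meets ψ σ (DeltaIdeal.mem_bounded hc) hcd with ⟨x, hx, hxσ⟩ | ⟨x, hx, hxσ⟩
    · exact h x (MDHLC.Hom.mem_comp.2 ⟨d, hd, hx⟩) hxσ
    · exact hcσ x hx hxσ
  · intro h x hx hxσ
    obtain ⟨c, hc, hxc⟩ := MDHLC.Hom.mem_comp.1 hx
    exact h c hc (mem_pullback.2 fun y hy hyσ => not_meets_compl ψ σ hxc hxσ hy hyσ)

end Pullback

/-- The locally compact Hausdorff space `Ψᵃ(A)`. -/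
abbrev psiA (A : MDHLC.{u}) : HLC.{u} :=
  ⟨TopCat.of (BClust A), inferInstanceAs (T2Space (BClust A)),
    inferInstanceAs (LocallyCompactSpace (BClust A))⟩

/-- The contravariant functor `Δᵃ : MDHLC ⟶ HLC`. -/
noncomputable def DeltaA : MDHLC.{u}ᵒᵖ ⥤ HLC.{u} where
  obj A := psiA A.unop
  map φ := ObjectProperty.homMk (TopCat.ofHom ⟨pullback φ.unop, continuous_pullback φ.unop⟩)
  map_id A := by
    refine InducedCategory.hom_ext (TopCat.hom_ext (ContinuousMap.ext fun σ => ?_))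
    exact pullback_id σ
  map_comp φ ψ := by
    refine InducedCategory.hom_ext (TopCat.hom_ext (ContinuousMap.ext fun σ => ?_))
    exact pullback_comp ψ.unop φ.unop σ

/-- The set `λᵍ_A(a) = {σ ∈ Ψᵃ(A) | a ∈ σ}`. -/
def lambdaG (A : MDHLC.{u}) (a : A) : Set (psiA A).obj :=
  {σ : BClust A | a ∈ σ.elems}

end RegionDuality

namespace RegionDuality

open LocalContactAlgebra (contact bounded)

/-! ### Clusters through contacting elements -/

/-! Write λ(a) for the set of bounded clusters through a. There are two claims: λ is an
LCA-isomorphism onto the regular closed sets of the cluster space, and the induced morphisms commute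
with every φ.

Everything about λ rests on having enough bounded clusters. If a ρ b, two applications of the prime
ideal theorem give a pair of mutually contacting ultrafilters, one through a and one through b.
Their union is a clan, so it generates a cluster. Replacing a beforehand by some c ∧ a in contact
with b, with c bounded, makes this cluster bounded (`exists_mem_of_contact`). Conversely, two
members of a bounded cluster are in contact, so λ preserves and reflects ρ. By (BC3), every nonzero
a contains some nonzero bounded b ≪ a, and a bounded cluster through b misses a*. Hence λ is an
order embedding (`le_iff`), and cl{σ : a ∉ σ} = λ(a*), int λ(a) = {σ : a* ∉ σ}, so each λ(a) is
regular closed. Completeness gives surjectivity: a regular closed F is λ of the supremum of all b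
with λ(b) ⊆ F. Finally λ(a) is compact exactly when a is bounded, since the interiors of the sets
λ(c), c bounded, cover the space.

For naturality, a* ∉ f_φ(σ) holds iff φ(a) meets σ, so f_φ⁻¹(int λ(a)) is the set of clusters met by
φ(a). A compact regular closed F belongs to one composite at a iff F ⊆ int λ(b) for a single b ∈
φ(a), and to the other iff φ(a) meets every σ ∈ F. These conditions agree because F is compact and
the δ-ideal φ(a) is closed under finite joins. -/

/-- An ideal avoiding `a` extends to a prime ideal avoiding `a`. -/
theorem exists_isPrime_notMem {A : Type u} [BooleanAlgebra A] {I : Order.Ideal A} {a : A}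
    (ha : a ∉ I) :
    ∃ P : Order.Ideal A, P.IsPrime ∧ I ≤ P ∧ a ∉ P := by
  have hd : Disjoint (Order.PFilter.principal a : Set A) (I : Set A) :=
    Set.disjoint_left.2 fun x hx hxI => ha (I.lower (Order.PFilter.mem_principal.1 hx) hxI)
  obtain ⟨P, hP, hIP, hPd⟩ := DistribLattice.prime_ideal_of_disjoint_filter_ideal hd
  exact ⟨P, hP, hIP, Set.disjoint_left.1 hPd (Order.PFilter.mem_principal.2 le_rfl)⟩

section Separation

variable {A : Type u} [BooleanAlgebra A] [LocalContactAlgebra A]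

/-- The elements that miss some member of the complement of a prime ideal form an ideal. -/
def remoteIdeal (P : Order.Ideal A) (hP : P.IsPrime) : Order.Ideal A where
  carrier := {y | ∃ x, x ∉ P ∧ ¬ contact x y}
  lower' := fun _ _ h ⟨x, hx, hxy⟩ => ⟨x, hx, fun h' => hxy (contact_mono_right h h')⟩
  nonempty' := ⟨⊥, ⊤, Order.Ideal.IsProper.top_notMem hP.toIsProper, not_contact_bot _⟩
  directed' := fun y ⟨x, hx, hxy⟩ z ⟨w, hw, hwz⟩ =>
    -- The complement of a prime ideal is closed under meets, so the two witnesses combine into x ⊓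
    -- w.
    ⟨y ⊔ z, ⟨x ⊓ w, fun h => (hP.mem_or_mem h).elim hx hw, fun h => (contact_sup.1 h).elim
      (fun h' => hxy (contact_mono inf_le_left le_rfl h'))
      (fun h' => hwz (contact_mono inf_le_right le_rfl h'))⟩, le_sup_left, le_sup_right⟩

/-- The elements that are not in contact with `b` form an ideal. -/
def missIdeal (b : A) : Order.Ideal A where
  carrier := {x | ¬ contact b x}
  lower' := fun _ _ h hx h' => hx (contact_mono_right h h')
  nonempty' := ⟨⊥, not_contact_bot _⟩
  directed' := fun x hx y hy =>
    ⟨x ⊔ y, fun h => (contact_sup.1 h).elim hx hy, le_sup_left, le_sup_right⟩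

/-- The complement of a prime ideal is a proper filter, so x ⊓ y is nonzero and hence in contact
with itself. -/
theorem contact_of_notMem {P : Order.Ideal A} (hP : P.IsPrime) {x y : A} (hx : x ∉ P)
    (hy : y ∉ P) : contact x y := by
  have hne : x ⊓ y ≠ ⊥ := fun h =>
    (hP.mem_or_mem (h ▸ Order.Ideal.bot_mem P : x ⊓ y ∈ P)).elim hx hy
  exact contact_mono inf_le_left inf_le_right
    (LocalContactAlgebra.isContact.refl_of_ne_bot _ hne)

/-- Two elements in contact lie in the complements of two mutually contacting prime ideals. -/
theorem exists_isPrime_contact {a b : A} (h : contact a b) :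
    ∃ P Q : Order.Ideal A, P.IsPrime ∧ Q.IsPrime ∧ a ∉ P ∧ b ∉ Q ∧
      ∀ x y, x ∉ P → y ∉ Q → contact x y := by
  -- P absorbs every element that misses b, so everything outside P is in contact with b. This is
  -- exactly the condition b ∉ `remoteIdeal P hP` needed to choose Q.
  obtain ⟨P, hP, hIP, haP⟩ := exists_isPrime_notMem (I := missIdeal b) (a := a)
    fun h' => h' (contact_symm h)
  obtain ⟨Q, hQ, hJQ, hbQ⟩ := exists_isPrime_notMem (I := remoteIdeal P hP) (a := b) (by
    rintro ⟨x, hx, hxb⟩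
    exact hx (hIP fun h' => hxb (contact_symm h')))
  refine ⟨P, Q, hP, hQ, haP, hbQ, fun x y hx hy => ?_⟩
  by_contra hxy
  exact hy (hJQ ⟨x, hx, hxy⟩)

/-! ### Bounded clusters detect contact and order -/

namespace BClust

/-- Two elements in contact belong to a common bounded cluster. -/
theorem exists_mem_of_contact {a b : A} (h : contact a b) :
    ∃ σ : BClust A, a ∈ σ.elems ∧ b ∈ σ.elems := by
  -- The bounded element c ⊓ a replaces a: it will lie in the cluster and witness that the cluster
  -- is bounded.
  obtain ⟨c, hc, hca⟩ := LocalContactAlgebra.bc2 _ _ (contact_symm h)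
  obtain ⟨P, Q, hP, hQ, haP, hbQ, hPQ⟩ := exists_isPrime_contact (contact_symm hca)
  -- The union of the two ultrafilters. Pairs inside one ultrafilter have a nonzero meet; mixed
  -- pairs are covered by `hPQ`.
  let p : Set A := {x | x ∉ P ∨ x ∉ Q}
  have hp : ∀ x y, x ∈ p → y ∈ p → alexandroff x y := by
    rintro x y (hx | hx) (hy | hy)
    exacts [Or.inl (contact_of_notMem hP hx hy), Or.inl (hPQ _ _ hx hy),
      Or.inl (contact_symm (hPQ _ _ hy hx)), Or.inl (contact_of_notMem hQ hx hy)]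
  have hcl := isCluster_of_clan (p := p)
    (Or.inl (Order.Ideal.IsProper.top_notMem hP.toIsProper))
    (by
      rintro x y (h | h)
      · by_contra! h'
        simp only [p, Set.mem_ofPred_eq, not_or, not_not] at h'
        exact h (Order.Ideal.sup_mem h'.1.1 h'.2.1)
      · by_contra! h'
        simp only [p, Set.mem_ofPred_eq, not_or, not_not] at h'
        exact h (Order.Ideal.sup_mem h'.1.2 h'.2.2)) hp
  have hac : c ⊓ a ∈ {x | ∀ y ∈ p, alexandroff x y} := fun y hy => hp _ _ (Or.inl haP) hy
  exact ⟨⟨⟨_, hcl⟩, c ⊓ a, hac, Order.Ideal.lower _ inf_le_left hc⟩,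
    hcl.mono inf_le_right hac, fun y hy => hp _ _ (Or.inr hbQ) hy⟩

/-- Shrinking one of the two elements to a bounded member of σ rules out the second alternative in
C_ρ, leaving genuine contact. -/
theorem contact_of_mem (σ : BClust A) {a b : A} (ha : a ∈ σ.elems) (hb : b ∈ σ.elems) :
    contact a b := by
  obtain ⟨c, hc, hcB, hca⟩ := σ.exists_bounded_le ha
  rcases σ.isCluster.contact_of_mem _ _ hc hb with h | h
  exacts [contact_mono hca le_rfl h, (h.1 hcB).elim]

/-- The complement of a nonzero element is missed by some bounded cluster. -/
theorem exists_compl_notMem {a : A} (ha : a ≠ ⊥) : ∃ σ : BClust A, aᶜ ∉ σ.elems := by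
  obtain ⟨b, hb, hb0, hba⟩ := LocalContactAlgebra.bc3 a ha
  obtain ⟨σ, hσ, -⟩ := exists_mem_of_contact (LocalContactAlgebra.isContact.refl_of_ne_bot b hb0)
  exact ⟨σ, σ.isCluster.compl_notMem hb hσ hba⟩

/-- If a ⊓ bᶜ is nonzero, some bounded cluster misses its complement aᶜ ⊔ b. That cluster contains a
⊓ bᶜ, hence a, but cannot contain b. -/
theorem le_iff {a b : A} : a ≤ b ↔ ∀ σ : BClust A, a ∈ σ.elems → b ∈ σ.elems := by
  refine ⟨fun h σ ha => σ.isCluster.mono h ha, fun h => ?_⟩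
  by_contra hab
  have hne : a ⊓ bᶜ ≠ ⊥ := fun h0 => hab (by
    rw [← sdiff_eq, sdiff_eq_bot_iff] at h0
    exact h0)
  obtain ⟨σ, hσ⟩ := exists_compl_notMem hne
  exact hσ (σ.isCluster.mono (by simp [compl_inf])
    (h σ (σ.isCluster.mono inf_le_left (σ.isCluster.mem_of_compl_notMem hσ))))

theorem notMem_sup {σ : BClust A} {a b : A} :
    a ⊔ b ∉ σ.elems ↔ a ∉ σ.elems ∧ b ∉ σ.elems := by
  rw [← not_or]
  exact not_congr ⟨σ.isCluster.mem_or_mem a b, fun h => h.elim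
    (σ.isCluster.mono le_sup_left) (σ.isCluster.mono le_sup_right)⟩

/-! ### Topology of the space of bounded clusters -/

/-- The sets `{σ | a ∉ σ}` form a base of open sets. -/
theorem isTopologicalBasis :
    TopologicalSpace.IsTopologicalBasis
      (Set.range fun a : A => {σ : BClust A | a ∉ σ.elems}) := by
  have hgen : (inferInstance : TopologicalSpace (BClust A)) = TopologicalSpace.generateFrom
      (Set.range fun a : A => {σ : BClust A | a ∉ σ.elems}) := by
    -- The subspace topology is generated by the traces of the generating open sets of the space of
    -- all clusters.
    refine Eq.trans (induced_generateFrom_eq (f := Subtype.val)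
      (b := Set.range fun a : A => {σ : Clust A | a ∈ σ.1}ᶜ)) ?_
    rw [← Set.range_comp]
    rfl
  refine ⟨?_, ?_, hgen⟩
  · rintro _ ⟨a, rfl⟩ _ ⟨b, rfl⟩ σ ⟨ha, hb⟩
    exact ⟨_, ⟨a ⊔ b, rfl⟩, notMem_sup.2 ⟨ha, hb⟩, fun τ hτ => notMem_sup.1 hτ⟩
  · exact Set.eq_univ_of_forall fun σ => ⟨_, ⟨⊥, rfl⟩, σ.isCluster.bot_notMem⟩

theorem exists_notMem_subset {U : Set (BClust A)} (hU : IsOpen U) {σ : BClust A} (hσ : σ ∈ U) :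
    ∃ a, a ∉ σ.elems ∧ ∀ τ : BClust A, a ∉ τ.elems → τ ∈ U := by
  obtain ⟨_, ⟨a, rfl⟩, ha, h⟩ := isTopologicalBasis.exists_subset_of_mem_open hσ hU
  exact ⟨a, ha, h⟩

theorem isClosed_mem (a : A) : IsClosed {σ : BClust A | a ∈ σ.elems} :=
  ⟨by simpa only [Set.compl_ofPred] using isOpen_notMem a⟩

/-- Density of {a ∉ σ} in the set of clusters through aᶜ: if a basic neighbourhood {c ∉ τ} of such a
σ missed it, then a ⊔ c = ⊤, so aᶜ ≤ c and c ∈ σ, a contradiction. -/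
theorem closure_notMem (a : A) :
    closure {σ : BClust A | a ∉ σ.elems} = {σ : BClust A | aᶜ ∈ σ.elems} := by
  refine Set.Subset.antisymm (closure_minimal (fun σ hσ => ?_) (isClosed_mem aᶜ))
    fun σ hσ => mem_closure_iff.2 fun U hU hσU => ?_
  · exact σ.isCluster.mem_of_compl_notMem (by rwa [compl_compl])
  · obtain ⟨c, hc, hcU⟩ := exists_notMem_subset hU hσU
    have hne : (a ⊔ c)ᶜ ≠ ⊥ := fun h => hc (σ.isCluster.mono (by
      rwa [compl_sup, ← sdiff_eq, sdiff_eq_bot_iff] at h) hσ)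
    obtain ⟨τ, hτ⟩ := exists_compl_notMem hne
    rw [compl_compl, notMem_sup] at hτ
    exact ⟨τ, hcU τ hτ.2, hτ.1⟩

theorem interior_mem (a : A) :
    interior {σ : BClust A | a ∈ σ.elems} = {σ : BClust A | aᶜ ∉ σ.elems} := by
  rw [interior_eq_compl_closure_compl]
  have h : {σ : BClust A | a ∈ σ.elems}ᶜ = {σ : BClust A | a ∉ σ.elems} := rfl
  rw [h, closure_notMem]
  rfl

/-- Compactness yields a bounded c with λ(a) ⊆ λ(c), whence a ≤ c. Conversely, for bounded a the set
is closed in the compact space of all clusters. -/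
theorem isCompact_mem_iff {a : A} :
    IsCompact {σ : BClust A | a ∈ σ.elems} ↔ a ∈ bounded (A := A) := by
  constructor
  · intro h
    -- Being contained in λ(c) for some bounded c passes to finite unions and holds locally: if b ∈
    -- σ is bounded and b ≪ c, then {cᶜ ∉ τ} is a neighbourhood of σ inside λ(c).
    obtain ⟨c, hc, hac⟩ : ∃ c ∈ bounded (A := A),
        {σ : BClust A | a ∈ σ.elems} ⊆ {σ | c ∈ σ.elems} := by
      refine h.induction_on (p := fun s => ∃ c ∈ bounded (A := A), s ⊆ {σ | c ∈ σ.elems})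
        ⟨⊥, Order.Ideal.bot_mem _, Set.empty_subset _⟩
        (fun s t hst ⟨c, hc, ht⟩ => ⟨c, hc, hst.trans ht⟩) ?_ ?_
      · rintro s t ⟨c, hc, hs⟩ ⟨d, hd, ht⟩
        exact ⟨c ⊔ d, Order.Ideal.sup_mem hc hd, Set.union_subset
          (fun σ hσ => σ.isCluster.mono le_sup_left (hs hσ))
          (fun σ hσ => σ.isCluster.mono le_sup_right (ht hσ))⟩
      · intro σ _
        obtain ⟨b, hb, hbB⟩ := σ.2
        obtain ⟨c, hc, hbc⟩ := exists_wellInside hbB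
        exact ⟨_, mem_nhdsWithin_of_mem_nhds ((isOpen_notMem cᶜ).mem_nhds
          (σ.isCluster.compl_notMem hbB hb hbc)), c, hc,
          fun τ hτ => τ.isCluster.mem_of_compl_notMem hτ⟩
    exact Order.Ideal.lower _ (le_iff.2 fun σ hσ => hac hσ) hc
  · intro ha
    refine Topology.IsInducing.subtypeVal.isCompact_iff.2 ?_
    -- No cluster through a is lost by restricting to bounded ones, because a itself is the bounded
    -- member.
    have h : (Subtype.val '' {σ : BClust A | a ∈ σ.elems} : Set (Clust A)) =
        {σ : Clust A | a ∈ σ.1} := by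
      refine Set.Subset.antisymm ?_ fun σ hσ => ⟨⟨σ, a, hσ, ha⟩, hσ, rfl⟩
      rintro _ ⟨σ, hσ, rfl⟩
      exact hσ
    refine Eq.mpr (congrArg IsCompact h) (IsClosed.isCompact ⟨?_⟩)
    exact Clust.isOpen_notMem a

end BClust

end Separation

/-! ### The isomorphism `λᵍ` -/

/-- The regular closed set of bounded clusters containing `a`. -/
def clusterSet {A : Type u} [BooleanAlgebra A] [LocalContactAlgebra A] (a : A) :
    RegularClosed (BClust A) where
  carrier := {σ | a ∈ σ.elems}
  closure_interior' := by rw [BClust.interior_mem, BClust.closure_notMem, compl_compl]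

theorem clusterSet_le_iff {A : Type u} [BooleanAlgebra A] [LocalContactAlgebra A] {a b : A} :
    clusterSet a ≤ clusterSet b ↔ a ≤ b :=
  BClust.le_iff.symm

/-- Completeness enters here: the preimage of F is the supremum of all b with λ(b) ⊆ F. Each
inclusion is checked on interiors, which are dense in regular closed sets. -/
theorem clusterSet_surjective (A : Type u) [CompleteBooleanAlgebra A] [LocalContactAlgebra A] :
    Function.Surjective (clusterSet (A := A)) := by
  intro F
  refine ⟨sSup {b | clusterSet b ≤ F}, le_antisymm ?_ ?_⟩
  · set a := sSup {b | clusterSet b ≤ F} with ha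
    have hsub : {σ : BClust A | aᶜ ∉ σ.elems} ⊆ F := by
      by_contra hne
      obtain ⟨σ, hσ, hσF⟩ := Set.not_subset.1 hne
      -- The neighbourhood {c ∉ τ} of σ avoids F, so every b in the family lies below c and a ≤ c.
      -- It also lies in int λ(a), so its closure λ(cᶜ) is inside λ(a) and cᶜ ≤ a. Together these
      -- force c = ⊤, against c ∉ σ.
      obtain ⟨c, hc, hcU⟩ := BClust.exists_notMem_subset
        ((BClust.isOpen_notMem aᶜ).inter F.isClosed.isOpen_compl) ⟨hσ, hσF⟩
      have hac : a ≤ c := sSup_le fun b hb => BClust.le_iff.2 fun τ hτ => by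
        by_contra hτc
        exact (hcU τ hτc).2 (hb hτ)
      have hca : cᶜ ≤ a := BClust.le_iff.2 fun τ hτ => by
        have hτ' : τ ∈ closure {τ : BClust A | c ∉ τ.elems} := by
          rw [BClust.closure_notMem]
          exact hτ
        refine closure_minimal (fun ν hν => ?_) (BClust.isClosed_mem a) hτ'
        exact ν.isCluster.mem_of_compl_notMem (hcU ν hν).1
      have htop : c = ⊤ := by
        rw [← sup_compl_eq_top (x := c)]
        exact (sup_eq_left.2 (hca.trans hac)).symm
      exact hc (htop ▸ σ.isCluster.top_mem)
    have h := closure_minimal hsub F.isClosed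
    rw [BClust.closure_notMem, compl_compl] at h
    exact h
  · have h : interior (F : Set (BClust A)) ⊆ clusterSet (sSup {b | clusterSet b ≤ F}) := by
      intro σ hσ
      obtain ⟨c, hc, hcU⟩ := BClust.exists_notMem_subset isOpen_interior hσ
      -- The closure of a basic neighbourhood inside F is λ(cᶜ), so cᶜ is one of the elements in the
      -- supremum.
      have hcF : clusterSet cᶜ ≤ F := by
        have h := closure_minimal (s := {τ : BClust A | c ∉ τ.elems})
          (fun τ hτ => interior_subset (hcU τ hτ)) F.isClosed
        rw [BClust.closure_notMem] at h
        exact h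
      exact σ.isCluster.mono (le_sSup hcF)
        (σ.isCluster.mem_of_compl_notMem (by rwa [compl_compl]))
    have hF := closure_minimal h (RegularClosed.isClosed _)
    rw [F.closure_interior] at hF
    exact hF

/-- The isomorphism `a ↦ {σ | a ∈ σ}` from a complete local contact algebra onto the algebra of
regular closed sets of its space of bounded clusters. -/
noncomputable def lambdaIso (A : Type u) [CompleteBooleanAlgebra A] [LocalContactAlgebra A] :
    LCAIso A (RegularClosed (BClust A)) where
  toIso := RelIso.ofSurjective
    (OrderEmbedding.ofMapLEIff clusterSet fun _ _ => clusterSet_le_iff) (clusterSet_surjective A)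
  contact_iff a b := ⟨fun ⟨σ, ha, hb⟩ => σ.contact_of_mem ha hb, fun h => by
    obtain ⟨σ, ha, hb⟩ := BClust.exists_mem_of_contact h
    exact ⟨σ, ha, hb⟩⟩
  bounded_iff _ := BClust.isCompact_mem_iff

/-! ### Isomorphisms of `MDHLC` induced by LCA-isomorphisms -/

namespace LCAIso

variable {A B : MDHLC.{u}}

/-- The inverse of an LCA-isomorphism. -/
def symm (e : LCAIso A B) : LCAIso B A where
  toIso := e.toIso.symm
  contact_iff a b := by
    rw [← e.contact_iff, OrderIso.apply_symm_apply, OrderIso.apply_symm_apply]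
  bounded_iff a := by rw [← e.bounded_iff, OrderIso.apply_symm_apply]

theorem tilde_comp_tilde_symm (e : LCAIso A B) : e.tilde ≫ e.symm.tilde = 𝟙 A := by
  refine MDHLC.Hom.ext' fun a x => MDHLC.Hom.mem_comp.trans ?_
  constructor
  · rintro ⟨b, hb, hx⟩
    refine ⟨hx.1, hx.2.mono le_rfl ?_⟩
    exact (OrderIso.symm_apply_le _).2 hb.2.le
  · rintro ⟨hx, hxa⟩
    -- Interpolating x ≪ c ≪ a with c bounded supplies e(c) as the intermediate element of the
    -- composite.
    obtain ⟨c, hc, hxc, hca⟩ := hxa.interp hx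
    refine ⟨e.toIso c, ⟨(e.bounded_iff c).2 hc, e.wellInside_iff.2 hca⟩, hx, ?_⟩
    exact hxc.mono le_rfl (OrderIso.symm_apply_apply _ _).ge

/-- The `MDHLC`-isomorphism induced by an LCA-isomorphism. -/
def tildeIso (e : LCAIso A B) : A ≅ B where
  hom := e.tilde
  inv := e.symm.tilde
  hom_inv_id := e.tilde_comp_tilde_symm
  -- `e.symm.symm` is definitionally `e`, so the same lemma gives the other composite.
  inv_hom_id := e.symm.tilde_comp_tilde_symm

end LCAIso

/-! ### Naturality -/

section Naturality

variable {A B : MDHLC.{u}}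

/-- Since {aᶜ ∉ τ} is the interior of λ(a), this computes its preimage under f_φ, the fact on which
naturality turns. -/
theorem compl_notMem_pullback {φ : A ⟶ B} {σ : BClust B} {a : A} :
    aᶜ ∉ (pullback φ σ).elems ↔ ∃ x ∈ φ.toFun a, x ∈ σ.elems := by
  rw [mem_pullback, compl_compl]
  push Not
  rfl

/-- A compact set of bounded clusters all of which meet a δ-ideal lies in the interior of the set
of clusters through a single member of that ideal. -/
theorem exists_mem_forall_compl_notMem {I : DeltaIdeal B} {K : Set (BClust B)} (hK : IsCompact K)
    (h : ∀ σ ∈ K, ∃ x ∈ I, x ∈ σ.elems) : ∃ b ∈ I, ∀ σ ∈ K, bᶜ ∉ σ.elems := by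
  refine hK.induction_on (p := fun s => ∃ b ∈ I, ∀ σ ∈ s, bᶜ ∉ σ.elems)
    ⟨⊥, DeltaIdeal.bot_mem I, fun σ hσ => hσ.elim⟩
    (fun s t hst ⟨b, hb, ht⟩ => ⟨b, hb, fun σ hσ => ht σ (hst hσ)⟩) ?_ ?_
  · rintro s t ⟨b, hb, hs⟩ ⟨c, hc, ht⟩
    refine ⟨b ⊔ c, DeltaIdeal.sup_mem hb hc, ?_⟩
    rintro σ (hσ | hσ) h'
    · exact hs σ hσ (σ.isCluster.mono (compl_le_compl le_sup_left) h')
    · exact ht σ hσ (σ.isCluster.mono (compl_le_compl le_sup_right) h')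
  · intro σ hσ
    obtain ⟨x, hx, hxσ⟩ := h σ hσ
    obtain ⟨b, hb, hxb⟩ := DeltaIdeal.exists_mem hx
    exact ⟨_, mem_nhdsWithin_of_mem_nhds ((BClust.isOpen_notMem bᶜ).mem_nhds
      (σ.isCluster.compl_notMem (DeltaIdeal.mem_bounded hx) hxσ hxb)), b, hb, fun _ hτ => hτ⟩

/-- The isomorphism `λᵍ_A` onto `Δᵗ(Δᵃ(A))`. -/
noncomputable def lambdaLCAIso (A : MDHLC.{u}) : LCAIso A (psiT (psiA A)) :=
  lambdaIso A

theorem mem_tilde_lambda {a : A} {F : RegularClosed (BClust A)} :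
    F ∈ ((lambdaLCAIso A).tilde.toFun a : DeltaIdeal (RegularClosed (BClust A))) ↔
      IsCompact (F : Set (BClust A)) ∧ ∀ σ ∈ F, aᶜ ∉ σ.elems := by
  have h : F ≪ clusterSet a ↔ (F : Set (BClust A)) ⊆ {σ | aᶜ ∉ σ.elems} := by
    rw [RegularClosed.wellInside_iff, ← BClust.interior_mem]
    rfl
  exact and_congr_right fun _ => h

/-- Both composites at a reduce to conditions on a compact F: one b ∈ φ(a) with F ⊆ int λ(b),
against a possibly different element of φ(a) for each σ ∈ F. -/
theorem lambda_naturality (φ : A ⟶ B) :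
    φ ≫ (lambdaLCAIso B).tilde =
      (lambdaLCAIso A).tilde ≫ (DeltaA.{u}.rightOp ⋙ DeltaT.{u}).map φ := by
  refine MDHLC.Hom.ext' fun a (F : RegularClosed (BClust B)) =>
    MDHLC.Hom.mem_comp.trans (Iff.trans ?_ MDHLC.Hom.mem_comp.symm)
  constructor
  · rintro ⟨b, hb, hF⟩
    obtain ⟨hFc, hFb⟩ := mem_tilde_lambda.1 hF
    have hsub : pullback φ '' (F : Set (BClust B)) ⊆ {σ | aᶜ ∉ σ.elems} := by
      rintro _ ⟨σ, hσ, rfl⟩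
      exact compl_notMem_pullback.2 ⟨b, hb, σ.isCluster.mem_of_compl_notMem (hFb σ hσ)⟩
    -- The right-hand composite needs an intermediate compact regular closed set, found between the
    -- compact image f_φ(F) and the open set int λ(a).
    obtain ⟨K, hK, hFK, hKa⟩ := RegularClosed.exists_between
      (hFc.image (continuous_pullback φ)) (BClust.isOpen_notMem aᶜ) hsub
    exact ⟨K, mem_tilde_lambda.2 ⟨hK, hKa⟩, hFc, Set.image_subset_iff.1 hFK⟩
  · rintro ⟨K, hK, hF⟩
    -- f_φ maps F into K ⊆ int λ(a), so φ(a) meets every σ ∈ F; compactness of F merges these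
    -- elements into one b.
    obtain ⟨b, hb, hFb⟩ := exists_mem_forall_compl_notMem (I := φ.toFun a) hF.1 fun σ hσ =>
      compl_notMem_pullback.1 ((mem_tilde_lambda.1 hK).2 _ (interior_subset (hF.2 hσ)))
    exact ⟨b, hb, mem_tilde_lambda.2 ⟨hF.1, hFb⟩⟩

end Naturality

end RegionDuality

theorem proposition3p9 :
    ∃ η : 𝟭 RegionDuality.MDHLC.{u} ≅
        RegionDuality.DeltaA.{u}.rightOp ⋙ RegionDuality.DeltaT.{u},
      ∀ A : RegionDuality.MDHLC.{u},
        ∃ l : RegionDuality.LCAIso A (RegionDuality.psiT (RegionDuality.psiA A)),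
          (∀ a : A, (l.toIso a : RegionDuality.RegularClosed (RegionDuality.psiA A).obj).carrier =
            RegionDuality.lambdaG A a) ∧
          η.hom.app A = l.tilde :=
  ⟨NatIso.ofComponents (fun A => (RegionDuality.lambdaLCAIso A).tildeIso)
      fun φ => RegionDuality.lambda_naturality φ,
    -- Both clauses hold by definition of `clusterSet` and `tildeIso`.
    fun A => ⟨RegionDuality.lambdaLCAIso A, fun _ => rfl, rfl⟩⟩
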